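/- All graphs are finite and simple. A graph is outerplanar if it has a planar embedding in which all the vertices lie on (the boundary of) a single face. A tree covering of a graph $G$ is a family of pairwise vertex-disjoint induced subgraphs of $G$, each of which is a tree, that together contain every vertex of $G$; it is minimum if no tree covering of $G$ has fewer trees. Two trees $T_1,T_2$ of a tree covering are adjacent if $G$ has an edge $uv$ with $u\in V(T_1)$ and $v\in V(T_2)$, and a tree of the covering is pendant if it is adjacent to exactly one other tree of the covering. Theorem 8.2 (pendant tree). Let $G$ be an outerplanar graph that contains a cycle. Then $G$ has a minimum tree covering that contains a pendant tree. -/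

import Mathlib

/-- The Euclidean plane. -/
abbrev EPlane : Type := EuclideanSpace ℝ (Fin 2)

/-- A planar embedding of a simple graph: distinct vertices are distinct points of the plane, an edge
`uv` is a simple arc from `u` to `v`, an edge passes through no vertex other than its two ends, and two
distinct edges meet at most in common ends. -/
structure PlanarEmbedding {V : Type*} (G : SimpleGraph V) where
  /-- the point representing a vertex -/
  point : V → EPlane
  /-- the arc (a subset of the plane) representing an edge -/
  arc : G.edgeSet → Set EPlane
  point_injective : Function.Injective point
  isArc : ∀ (e : G.edgeSet) (u v : V), (e : Sym2 V) = s(u, v) →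
    ∃ γ : Path (point u) (point v), Function.Injective γ ∧ Set.range γ = arc e
  mem_of_point_mem_arc : ∀ (e : G.edgeSet) (w : V), point w ∈ arc e → w ∈ (e : Sym2 V)
  arc_inter_arc : ∀ e f : G.edgeSet, e ≠ f → ∀ x ∈ arc e, x ∈ arc f →
    ∃ w : V, w ∈ (e : Sym2 V) ∧ w ∈ (f : Sym2 V) ∧ x = point w

namespace PlanarEmbedding

/-- The subset of the plane covered by the vertices and edges. -/
def drawing {V : Type*} {G : SimpleGraph V} (φ : PlanarEmbedding G) : Set EPlane :=
  Set.range φ.point ∪ ⋃ e : G.edgeSet, φ.arc e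

/-- The faces are the connected components of the complement of the drawing. -/
def IsFace {V : Type*} {G : SimpleGraph V} (φ : PlanarEmbedding G) (F : Set EPlane) : Prop :=
  ∃ x ∈ φ.drawingᶜ, F = connectedComponentIn φ.drawingᶜ x

end PlanarEmbedding

namespace SimpleGraph

/-- A graph is outerplanar if it has a planar embedding in which all the vertices lie on (the boundary
of) a single face. -/
def IsOuterplanar {V : Type*} (G : SimpleGraph V) : Prop :=
  ∃ φ : PlanarEmbedding G, ∃ F : Set EPlane, φ.IsFace F ∧ ∀ v : V, φ.point v ∈ frontier F

/-- A tree covering: a family of vertex-disjoint induced trees covering all the vertices. An induced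
tree is given by its vertex set. -/
structure IsTreeCovering {V : Type*} (G : SimpleGraph V) (𝒯 : Set (Set V)) : Prop where
  isTree : ∀ T ∈ 𝒯, (G.induce T).IsTree
  disjoint : ∀ S ∈ 𝒯, ∀ T ∈ 𝒯, S ≠ T → Disjoint S T
  cover : ∀ v : V, ∃ T ∈ 𝒯, v ∈ T

/-- A minimum tree covering: a tree covering with the least possible number of trees. -/
def IsMinimumTreeCovering {V : Type*} (G : SimpleGraph V) (𝒯 : Set (Set V)) : Prop :=
  G.IsTreeCovering 𝒯 ∧ ∀ 𝒮 : Set (Set V), G.IsTreeCovering 𝒮 → 𝒯.encard ≤ 𝒮.encard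

/-- Two trees (given by their vertex sets) are adjacent if some edge of the graph joins a vertex of the
one to a vertex of the other. -/
def AdjacentTrees {V : Type*} (G : SimpleGraph V) (S T : Set V) : Prop :=
  ∃ u ∈ S, ∃ v ∈ T, G.Adj u v

/-- A tree of the covering `𝒯` is pendant if it is adjacent to exactly one other tree of `𝒯`. -/
def IsPendantTree {V : Type*} (G : SimpleGraph V) (𝒯 : Set (Set V)) (T : Set V) : Prop :=
  T ∈ 𝒯 ∧ ∃! S : Set V, S ∈ 𝒯 ∧ S ≠ T ∧ G.AdjacentTrees T S

end SimpleGraph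

/-! The trees of a covering form a spanning forest whose trees are induced, and a forest with `m`
edges on `n` vertices has `n - m` trees. A minimum tree covering is therefore an induced forest with
as many edges as possible, and such a forest with a pendant tree is wanted.

Topology enters only through two excluded minors. A new vertex placed in the face that sees all
vertices can be joined to each of them, so a K4 or K_{2,3} model in an outerplanar graph would draw
K5 or K_{3,3} in the plane. In these drawings edges with a common end may overlap. They are still
impossible: for two disjoint arcs the difference of their points never vanishes on a square, hence
has a logarithm there, and the resulting integer relations contradict each other modulo 4.

The combinatorial part is an induction over weighted graphs, because the reductions produce parallel
connections. An edge of weight `m` carries `m - 1` hidden vertices joined to both ends. Each hidden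
vertex can hang on one end as a leaf if the ends lie in different trees, and must be a singleton if
they lie in one tree. Using the edge thus changes the number of forest edges by `1 - (m - 1) = 2 -
m`: a gain for weight 1, nothing for weight 2, a loss from weight 3 on. This is why `WGraph.Valid`
allows weights up to 2 and `WGraph.val` counts only weight 1. A weight-2 edge in an optimal forest
is as good as a pendant tree, since its hidden vertex becomes a singleton whose two neighbours share
a tree.

A graph without K4 minor has a vertex `v` of degree at most 2 other than a prescribed root `r`
(`exists_degree_le_two`). A light edge at `v` allows deletion of a leaf or a series or parallel
reduction (`Good.of_light_leaf`, `Good.of_reduce`). If every edge at `v` is heavy, then `v` is a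
pendant singleton, or a weight-2 edge can be used, or both weights are at least 3; in the last case
the absence of K_{2,3} makes `v` a cut vertex, and induction applies to the side without `r`, rooted
at `v` (`Good.of_split`). The root keeps the pendant tree away from the vertex where the pieces are
glued. -/

/-! ### Continuous logarithms and winding of paths -/

open Complex in
theorem exists_continuous_log {X : Type*} [TopologicalSpace X] [LocallyPathConnectedSpace X]
    [SimplyConnectedSpace X] {f : X → ℂ} (hf : Continuous f) (h0 : ∀ x, f x ≠ 0) :
    ∃ L : X → ℂ, Continuous L ∧ ∀ x, exp (L x) = f x := by
  obtain ⟨x₀⟩ : Nonempty X := inferInstance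
  obtain ⟨L, ⟨-, hL⟩, -⟩ := isCoveringMapOn_exp.existsUnique_continuousMap_lifts
    (⟨f, hf⟩ : C(X, ℂ)) (exp_log (h0 x₀)) h0
  exact ⟨L, L.continuous, fun x => congrFun hL x⟩

-- Two lifts differ by an integer multiple of 2πi that depends continuously on the parameter and is
-- therefore constant.
open Complex Real in
theorem log_lift_sub_eq {f L L' : ℝ → ℂ} (hL : Continuous L) (hL' : Continuous L')
    (h : ∀ t, exp (L t) = f t) (h' : ∀ t, exp (L' t) = f t) (s t : ℝ) :
    L t - L s = L' t - L' s := by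
  have key : ∀ t, ∃ n : ℤ, L t = L' t + n * (2 * π * I) := fun t =>
    Complex.exp_eq_exp_iff_exists_int.1 ((h t).trans (h' t).symm)
  choose n hn using key
  have hcont : Continuous fun t => (n t : ℝ) := by
    have : (fun t => (n t : ℝ)) = fun t => ((L t - L' t) / (2 * π * I)).re := by
      funext t
      rw [hn t, add_sub_cancel_left, mul_div_assoc, div_self two_pi_I_ne_zero, mul_one]
      simp
    rw [this]
    fun_prop
  have hn' : Continuous n := Int.isClosedEmbedding_coe_real.isEmbedding.continuous_iff.2 hcont
  have hconst : n t = n s := PreconnectedSpace.constant inferInstance hn'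
  rw [hn t, hn s, hconst]
  ring

open Complex Real in
theorem exists_winding {p w z : ℂ} (δ : Path w z) (hp : p ∉ Set.range δ) :
    ∃ N : ℤ, ∀ L : ℝ → ℂ, Continuous L → (∀ t, exp (L t) = δ.extend t - p) →
      L 1 - L 0 = log (z - p) - log (w - p) + N * (2 * π * I) := by
  have hne : ∀ t, δ.extend t - p ≠ 0 := fun t ht => hp (by
    rw [← δ.extend_range]; exact ⟨t, sub_eq_zero.1 ht⟩)
  obtain ⟨L', hL', h'⟩ := exists_continuous_log (X := ℝ)
    (f := fun t => δ.extend t - p) (by fun_prop) hne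
  have h1 : exp (L' 1) = exp (log (z - p)) := by
    have := hne 1
    rw [h' 1]; simp at this ⊢; rw [Complex.exp_log this]
  have h0 : exp (L' 0) = exp (log (w - p)) := by
    have := hne 0
    rw [h' 0]; simp at this ⊢; rw [Complex.exp_log this]
  obtain ⟨a, ha⟩ := Complex.exp_eq_exp_iff_exists_int.1 h1
  obtain ⟨b, hb⟩ := Complex.exp_eq_exp_iff_exists_int.1 h0
  refine ⟨a - b, fun L hL h => ?_⟩
  rw [log_lift_sub_eq hL hL' h h' 0 1, ha, hb]
  push_cast
  ring

open Complex Real in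
/-- The winding defect of a path around a point off it: the total change of the argument along the
path differs from the difference of the principal arguments of its ends by this many turns. -/
noncomputable def turns (p : ℂ) {w z : ℂ} (δ : Path w z) : ℤ :=
  open Classical in
  if hp : p ∉ Set.range δ then (exists_winding δ hp).choose else 0

open Complex Real in
theorem turns_spec {p w z : ℂ} {δ : Path w z} (hp : p ∉ Set.range δ) {L : ℝ → ℂ}
    (hL : Continuous L) (h : ∀ t, exp (L t) = δ.extend t - p) :
    L 1 - L 0 = log (z - p) - log (w - p) + turns p δ * (2 * π * I) := by
  rw [turns, dif_pos hp]
  exact (exists_winding δ hp).choose_spec L hL h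

-- Opposite numbers have logarithms that differ by an odd multiple of πi. The oddness is the source
-- of the parity contradictions below.
open Complex Real in
theorem exists_log_sign : ∃ ε : ℂ → ℂ → ℤ, (∀ a b, ε a b = - ε b a) ∧
    ∀ a b, a ≠ b → Odd (ε a b) ∧ log (b - a) - log (a - b) = ε a b * (π * I) := by
  have key : ∀ a b : ℂ, a ≠ b → ∃ n : ℤ, Odd n ∧ log (b - a) - log (a - b) = n * (π * I) := by
    intro a b hab
    have h : exp (log (b - a)) = exp (log (a - b) + π * I) := by
      rw [Complex.exp_add, Complex.exp_log (sub_ne_zero.2 hab.symm),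
        Complex.exp_log (sub_ne_zero.2 hab), Complex.exp_pi_mul_I]
      ring
    obtain ⟨n, hn⟩ := Complex.exp_eq_exp_iff_exists_int.1 h
    refine ⟨2 * n + 1, ⟨n, rfl⟩, ?_⟩
    rw [hn]; push_cast; ring
  choose! n hodd hn using key
  -- The value 0 on the diagonal makes antisymmetry hold without a side condition.
  refine ⟨fun a b => if a = b then 0 else n a b, fun a b => ?_, fun a b hab => ?_⟩
  · by_cases hab : a = b
    · simp [hab]
    · simp only [hab, Ne.symm hab, if_false]
      have h1 := hn a b hab
      have h2 := hn b a (Ne.symm hab)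
      have h3 : ((n a b : ℂ) + n b a) * (π * I) = 0 := by
        rw [add_mul, ← h1, ← h2]; ring
      have h4 : ((n a b : ℂ) + n b a) = 0 := by
        rcases mul_eq_zero.1 h3 with h | h
        · exact h
        · simp at h
      have : n a b + n b a = 0 := by exact_mod_cast h4
      omega
  · simpa [hab] using ⟨hodd a b hab, hn a b hab⟩

-- The difference `δ t - γ s` has no zero, so it has a continuous logarithm in both variables, and
-- the changes of this logarithm along the four sides of the unit square cancel. Expressing each
-- change by principal logarithms and `turns` gives the relation.
open Complex Real in
theorem turns_relation {ε : ℂ → ℂ → ℤ}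
    (hε : ∀ a b, a ≠ b → Odd (ε a b) ∧ log (b - a) - log (a - b) = ε a b * (π * I))
    {u v w z : ℂ} (γ : Path u v) (δ : Path w z)
    (hd : Disjoint (Set.range γ) (Set.range δ)) :
    ε u z - ε u w - ε v z + ε v w
      + 2 * (turns u δ - turns v δ + turns z γ - turns w γ) = 0 := by
  have hγ : ∀ s, γ.extend s ∈ Set.range γ := fun s => by
    rw [← γ.extend_range]; exact ⟨s, rfl⟩
  have hδ : ∀ s, δ.extend s ∈ Set.range δ := fun s => by
    rw [← δ.extend_range]; exact ⟨s, rfl⟩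
  have hne : ∀ s t, γ.extend s ≠ δ.extend t := fun s t => hd.ne_of_mem (hγ s) (hδ t)
  obtain ⟨L, hL, h⟩ := exists_continuous_log (X := ℝ × ℝ)
    (f := fun x => δ.extend x.2 - γ.extend x.1) (by fun_prop)
    (fun x => sub_ne_zero.2 (hne x.1 x.2).symm)
  have hu : u ∈ Set.range γ := ⟨0, γ.source⟩
  have hv : v ∈ Set.range γ := ⟨1, γ.target⟩
  have hw : w ∈ Set.range δ := ⟨0, δ.source⟩
  have hz : z ∈ Set.range δ := ⟨1, δ.target⟩
  have e1 := turns_spec (p := u) (δ := δ) (fun hh => hd.ne_of_mem hu hh rfl)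
    (L := fun t => L (0, t)) (by fun_prop) (fun t => by simp [h])
  have e2 := turns_spec (p := v) (δ := δ) (fun hh => hd.ne_of_mem hv hh rfl)
    (L := fun t => L (1, t)) (by fun_prop) (fun t => by simp [h])
  -- On these two sides the moving point is on `γ`, so the difference has the opposite sign; adding
  -- πi to the logarithm corrects this.
  have e3 := turns_spec (p := w) (δ := γ) (fun hh => hd.ne_of_mem hh hw rfl)
    (L := fun t => L (t, 0) + π * I) (by fun_prop)
    (fun t => by simp [h, Complex.exp_add])
  have e4 := turns_spec (p := z) (δ := γ) (fun hh => hd.ne_of_mem hh hz rfl)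
    (L := fun t => L (t, 1) + π * I) (by fun_prop)
    (fun t => by simp [h, Complex.exp_add])
  have f1 := (hε u z (hd.ne_of_mem hu hz)).2
  have f2 := (hε u w (hd.ne_of_mem hu hw)).2
  have f3 := (hε v z (hd.ne_of_mem hv hz)).2
  have f4 := (hε v w (hd.ne_of_mem hv hw)).2
  have key : ((ε u z - ε u w - ε v z + ε v w
      + 2 * (turns u δ - turns v δ + turns z γ - turns w γ) : ℤ) : ℂ) * (π * I) = 0 := by
    push_cast
    linear_combination (-1 : ℂ) * f1 + f2 + f3 - f4 - e1 + e2 + e3 - e4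
  rcases mul_eq_zero.1 key with h | h
  · exact_mod_cast h
  · simp at h

/-! ### K5 and K_{3,3} cannot be drawn with disjoint independent edges -/

/-- Add the relations of the 15 pairs of disjoint edges. Each `n i k l` occurs twice, so these terms
contribute 0 modulo 4. Each `e i j` with `i < j` has an even total coefficient and is odd, so only
the sum of the signs matters. Among the three pairings of a 4-set the interleaved one contributes -2
and the others 0, in total -10, which is not 0 modulo 4. -/
theorem parity_K5 {e : Fin 5 → Fin 5 → ℤ} {n : Fin 5 → Fin 5 → Fin 5 → ℤ}
    (hanti : ∀ i j, e i j = - e j i) (hodd : ∀ i j, i ≠ j → Odd (e i j))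
    (rel : ∀ i j k l, i ≠ j → k ≠ l → i ≠ k → i ≠ l → j ≠ k → j ≠ l →
      e i l - e i k - e j l + e j k + 2 * (n i k l - n j k l + n l i j - n k i j) = 0) :
    False := by
  have r1 := rel 0 1 2 3 (by decide) (by decide) (by decide) (by decide) (by decide) (by decide)
  have r2 := rel 0 1 2 4 (by decide) (by decide) (by decide) (by decide) (by decide) (by decide)
  have r3 := rel 0 1 3 4 (by decide) (by decide) (by decide) (by decide) (by decide) (by decide)
  have r4 := rel 0 2 1 3 (by decide) (by decide) (by decide) (by decide) (by decide) (by decide)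
  have r5 := rel 0 2 1 4 (by decide) (by decide) (by decide) (by decide) (by decide) (by decide)
  have r6 := rel 0 2 3 4 (by decide) (by decide) (by decide) (by decide) (by decide) (by decide)
  have r7 := rel 0 3 1 2 (by decide) (by decide) (by decide) (by decide) (by decide) (by decide)
  have r8 := rel 0 3 1 4 (by decide) (by decide) (by decide) (by decide) (by decide) (by decide)
  have r9 := rel 0 3 2 4 (by decide) (by decide) (by decide) (by decide) (by decide) (by decide)
  have r10 := rel 0 4 1 2 (by decide) (by decide) (by decide) (by decide) (by decide) (by decide)
  have r11 := rel 0 4 1 3 (by decide) (by decide) (by decide) (by decide) (by decide) (by decide)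
  have r12 := rel 0 4 2 3 (by decide) (by decide) (by decide) (by decide) (by decide) (by decide)
  have r13 := rel 1 2 3 4 (by decide) (by decide) (by decide) (by decide) (by decide) (by decide)
  have r14 := rel 1 3 2 4 (by decide) (by decide) (by decide) (by decide) (by decide) (by decide)
  have r15 := rel 1 4 2 3 (by decide) (by decide) (by decide) (by decide) (by decide) (by decide)
  rw [hanti 2 1] at r4 r5
  rw [hanti 3 1, hanti 3 2] at r7
  rw [hanti 3 1] at r8
  rw [hanti 3 2] at r9
  rw [hanti 4 1, hanti 4 2] at r10
  rw [hanti 4 1, hanti 4 3] at r11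
  rw [hanti 4 2, hanti 4 3] at r12
  rw [hanti 3 2] at r14
  rw [hanti 4 3, hanti 4 2] at r15
  obtain ⟨b01, h01⟩ := hodd 0 1 (by decide)
  obtain ⟨b02, h02⟩ := hodd 0 2 (by decide)
  obtain ⟨b03, h03⟩ := hodd 0 3 (by decide)
  obtain ⟨b04, h04⟩ := hodd 0 4 (by decide)
  obtain ⟨b12, h12⟩ := hodd 1 2 (by decide)
  obtain ⟨b13, h13⟩ := hodd 1 3 (by decide)
  obtain ⟨b14, h14⟩ := hodd 1 4 (by decide)
  obtain ⟨b23, h23⟩ := hodd 2 3 (by decide)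
  obtain ⟨b24, h24⟩ := hodd 2 4 (by decide)
  obtain ⟨b34, h34⟩ := hodd 3 4 (by decide)
  omega

/-- The complete graph on five vertices cannot be drawn in the plane, even if adjacent edges may
meet. -/
theorem not_planar_K5 {P : Fin 5 → ℂ} (γ : ∀ i j, Path (P i) (P j))
    (h : ∀ i j k l, i ≠ j → k ≠ l → i ≠ k → i ≠ l → j ≠ k → j ≠ l →
      Disjoint (Set.range (γ i j)) (Set.range (γ k l))) : False := by
  obtain ⟨ε, hanti, hε⟩ := exists_log_sign
  have hinj : ∀ i j, i ≠ j → P i ≠ P j := by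
    intro i j hij
    obtain ⟨k, l, hk⟩ : ∃ k l : Fin 5, k ≠ l ∧ i ≠ k ∧ i ≠ l ∧ j ≠ k ∧ j ≠ l := by
      revert i j; decide
    exact (h i k j l (by tauto) (by tauto) hij (by tauto) (by tauto) (by tauto)).ne_of_mem
      ⟨0, (γ i k).source⟩ ⟨0, (γ j l).source⟩
  exact parity_K5 (e := fun i j => ε (P i) (P j)) (n := fun i j k => turns (P i) (γ j k))
    (fun i j => hanti _ _) (fun i j hij => (hε _ _ (hinj i j hij)).1)
    (fun i j k l h1 h2 h3 h4 h5 h6 =>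
      turns_relation hε (γ i j) (γ k l) (h i j k l h1 h2 h3 h4 h5 h6))

/-- The same count over 18 pairs of disjoint edges: the winding terms cancel modulo 4, the signs of
the `b` and of the `c` sum to 0, and those of the `a` sum to -18, which is 2 modulo 4. -/
theorem parity_K33 {a b c : Fin 3 → Fin 3 → ℤ} {m n : Fin 3 → Fin 3 → Fin 3 → ℤ}
    (hanti : ∀ i j, c i j = - c j i)
    (ha : ∀ i j, i ≠ j → Odd (a i j)) (hc : ∀ i j, i ≠ j → Odd (c i j))
    (hb : ∀ i j, Odd (b i j))
    (rel : ∀ i j k l, i ≠ k → j ≠ l →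
      b i l - a i k - c j l - b k j + 2 * (m i k l - n j k l + n l i j - m k i j) = 0) :
    False := by
  have r1 := rel 0 0 1 1 (by decide) (by decide)
  have r2 := rel 0 0 1 2 (by decide) (by decide)
  have r3 := rel 0 0 2 1 (by decide) (by decide)
  have r4 := rel 0 0 2 2 (by decide) (by decide)
  have r5 := rel 0 1 1 0 (by decide) (by decide)
  have r6 := rel 0 1 1 2 (by decide) (by decide)
  have r7 := rel 0 1 2 0 (by decide) (by decide)
  have r8 := rel 0 1 2 2 (by decide) (by decide)
  have r9 := rel 0 2 1 0 (by decide) (by decide)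
  have r10 := rel 0 2 1 1 (by decide) (by decide)
  have r11 := rel 0 2 2 0 (by decide) (by decide)
  have r12 := rel 0 2 2 1 (by decide) (by decide)
  have r13 := rel 1 0 2 1 (by decide) (by decide)
  have r14 := rel 1 0 2 2 (by decide) (by decide)
  have r15 := rel 1 1 2 0 (by decide) (by decide)
  have r16 := rel 1 1 2 2 (by decide) (by decide)
  have r17 := rel 1 2 2 0 (by decide) (by decide)
  have r18 := rel 1 2 2 1 (by decide) (by decide)
  obtain ⟨a01, ha01⟩ := ha 0 1 (by decide)
  obtain ⟨a02, ha02⟩ := ha 0 2 (by decide)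
  obtain ⟨a12, ha12⟩ := ha 1 2 (by decide)
  obtain ⟨c01, hc01⟩ := hc 0 1 (by decide)
  obtain ⟨c02, hc02⟩ := hc 0 2 (by decide)
  obtain ⟨c12, hc12⟩ := hc 1 2 (by decide)
  choose b' hb' using hb
  simp only [hanti 1 0, hanti 2 0, hanti 2 1, ha01, ha02, ha12, hc01, hc02, hc12, hb'] at r1 r2 r3 r4 r5 r6 r7 r8 r9 r10 r11 r12 r13 r14 r15 r16 r17 r18
  omega

/-- The complete bipartite graph on three and three vertices cannot be drawn in the plane, even if
adjacent edges may meet. -/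
theorem not_planar_K33 {P Q : Fin 3 → ℂ} (γ : ∀ i j, Path (P i) (Q j))
    (h : ∀ i j k l, i ≠ k → j ≠ l →
      Disjoint (Set.range (γ i j)) (Set.range (γ k l))) : False := by
  obtain ⟨ε, hanti, hε⟩ := exists_log_sign
  have hP : ∀ i j, i ≠ j → P i ≠ P j := fun i j hij =>
    (h i 0 j 1 hij (by decide)).ne_of_mem ⟨0, (γ i 0).source⟩ ⟨0, (γ j 1).source⟩
  have hQ : ∀ i j, i ≠ j → Q i ≠ Q j := fun i j hij =>
    (h 0 i 1 j (by decide) hij).ne_of_mem ⟨1, (γ 0 i).target⟩ ⟨1, (γ 1 j).target⟩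
  have hPQ : ∀ i j, P i ≠ Q j := by
    intro i j
    obtain ⟨k, l, hk⟩ : ∃ k l : Fin 3, i ≠ k ∧ l ≠ j := by revert i j; decide
    exact (h i l k j hk.1 hk.2).ne_of_mem ⟨0, (γ i l).source⟩ ⟨1, (γ k j).target⟩
  exact parity_K33 (a := fun i j => ε (P i) (P j)) (c := fun i j => ε (Q i) (Q j))
    (b := fun i j => ε (P i) (Q j)) (m := fun i j k => turns (P i) (γ j k))
    (n := fun i j k => turns (Q i) (γ j k))
    (fun i j => hanti _ _) (fun i j hij => (hε _ _ (hP i j hij)).1) (fun i j hij => (hε _ _ (hQ i j hij)).1)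
    (fun i j => (hε _ _ (hPQ i j)).1)
    (fun i j k l h1 h2 => by
      have := turns_relation hε (γ i j) (γ k l) (h i j k l h1 h2)
      rw [hanti (Q j) (P k)] at this
      linarith)

/-- Sets in place of arcs: a set may contain much more than the path inside it, and sets whose index
pairs share an index may overlap. This is the form in which minors and the apex provide edges. -/
theorem not_joined_K5 {P : Fin 5 → EPlane} {R : Fin 5 → Fin 5 → Set EPlane}
    (hj : ∀ i j, i ≠ j → JoinedIn (R i j) (P i) (P j))
    (hd : ∀ i j k l, i ≠ j → k ≠ l → i ≠ k → i ≠ l → j ≠ k → j ≠ l →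
      Disjoint (R i j) (R k l)) : False := by
  have key : ∀ i j, ∃ γ : Path (P i) (P j), i ≠ j → Set.range γ ⊆ R i j := by
    intro i j
    by_cases h : i = j
    · subst h
      exact ⟨Path.refl _, fun h => (h rfl).elim⟩
    · obtain ⟨γ, hγ⟩ := hj i j h
      exact ⟨γ, fun _ => by rintro _ ⟨t, rfl⟩; exact hγ t⟩
  choose γ hγ using key
  let f : EPlane ≃L[ℝ] ℂ := Complex.orthonormalBasisOneI.repr.symm.toContinuousLinearEquiv
  refine not_planar_K5 (P := fun i => f (P i)) (fun i j => (γ i j).map f.continuous)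
    fun i j k l h1 h2 h3 h4 h5 h6 => ?_
  have := (hd i j k l h1 h2 h3 h4 h5 h6).mono (hγ i j h1) (hγ k l h2)
  simp only [Path.map_coe, Set.range_comp]
  exact (Set.disjoint_image_iff f.injective).2 this

theorem not_joined_K33 {P Q : Fin 3 → EPlane} {R : Fin 3 → Fin 3 → Set EPlane}
    (hj : ∀ i j, JoinedIn (R i j) (P i) (Q j))
    (hd : ∀ i j k l, i ≠ k → j ≠ l → Disjoint (R i j) (R k l)) : False := by
  have key : ∀ i j, ∃ γ : Path (P i) (Q j), Set.range γ ⊆ R i j := by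
    intro i j
    obtain ⟨γ, hγ⟩ := hj i j
    exact ⟨γ, by rintro _ ⟨t, rfl⟩; exact hγ t⟩
  choose γ hγ using key
  let f : EPlane ≃L[ℝ] ℂ := Complex.orthonormalBasisOneI.repr.symm.toContinuousLinearEquiv
  refine not_planar_K33 (P := fun i => f (P i)) (Q := fun i => f (Q i))
    (fun i j => (γ i j).map f.continuous) fun i j k l h1 h2 => ?_
  have := (hd i j k l h1 h2).mono (hγ i j) (hγ k l)
  simp only [Path.map_coe, Set.range_comp]
  exact (Set.disjoint_image_iff f.injective).2 this

/-! ### Connected vertex sets -/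

namespace SimpleGraph

variable {V : Type*} {G H : SimpleGraph V} {S T : Set V} {x y z : V}

/-- The edges of `G` with both ends in `S`, as a graph on all the vertices. -/
def within (G : SimpleGraph V) (S : Set V) : SimpleGraph V where
  Adj x y := G.Adj x y ∧ x ∈ S ∧ y ∈ S
  symm := ⟨fun _ _ h => ⟨h.1.symm, h.2.2, h.2.1⟩⟩
  loopless := ⟨fun _ h => h.1.ne rfl⟩

theorem within_le : G.within S ≤ G := fun _ _ h => h.1

theorem within_mono (hGH : G ≤ H) (hST : S ⊆ T) : G.within S ≤ H.within T :=
  fun _ _ h => ⟨hGH h.1, hST h.2.1, hST h.2.2⟩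

/-- The set `S` of vertices is connected in `G` or empty. -/
def ConnOn (G : SimpleGraph V) (S : Set V) : Prop :=
  ∀ x ∈ S, ∀ y ∈ S, (G.within S).Reachable x y

/-- Some edge joins `S` to `T`. -/
def Touch (G : SimpleGraph V) (S T : Set V) : Prop :=
  ∃ x ∈ S, ∃ y ∈ T, G.Adj x y

theorem Touch.symm (h : G.Touch S T) : G.Touch T S :=
  let ⟨x, hx, y, hy, hxy⟩ := h
  ⟨y, hy, x, hx, hxy.symm⟩

theorem ConnOn.union (hS : G.ConnOn S) (hT : G.ConnOn T) (h : G.Touch S T) :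
    G.ConnOn (S ∪ T) := by
  obtain ⟨a, ha, b, hb, hab⟩ := h
  have hab' : (G.within (S ∪ T)).Reachable a b := Adj.reachable ⟨hab, Or.inl ha, Or.inr hb⟩
  have hS' : ∀ x ∈ S, (G.within (S ∪ T)).Reachable x a := fun x hx =>
    (hS x hx a ha).mono (within_mono le_rfl Set.subset_union_left)
  have hT' : ∀ x ∈ T, (G.within (S ∪ T)).Reachable x a := fun x hx =>
    ((hT x hx b hb).mono (within_mono le_rfl Set.subset_union_right)).trans hab'.symm
  intro x hx y hy
  exact (hx.elim (hS' x) (hT' x)).trans (hy.elim (hS' y) (hT' y)).symm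

theorem Reachable.induction_on {P : V → Prop} (h : G.Reachable x y) (hx : P x)
    (step : ∀ p q, G.Reachable x p → P p → G.Adj p q → P q) : P y := by
  rw [reachable_iff_reflTransGen] at h
  induction h with
  | refl => exact hx
  | tail hab hbc ih => exact step _ _ ((reachable_iff_reflTransGen _ _).2 hab) ih hbc

end SimpleGraph

/-! ### Regions of a drawing and an apex in a face -/

namespace PlanarEmbedding

open SimpleGraph

variable {V : Type*} {G : SimpleGraph V} (φ : PlanarEmbedding G) {S T : Set V} {x y : V}

/-- The part of the drawing spanned by the vertices in `S`. -/
def region (S : Set V) : Set EPlane :=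
  φ.point '' S ∪ ⋃ e ∈ {e : G.edgeSet | ∀ v ∈ (e : Sym2 V), v ∈ S}, φ.arc e

theorem region_subset_drawing : φ.region S ⊆ φ.drawing := by
  rintro p (⟨v, -, rfl⟩ | hp)
  · exact Or.inl ⟨v, rfl⟩
  · simp only [Set.mem_iUnion] at hp
    obtain ⟨e, -, he⟩ := hp
    exact Or.inr (Set.mem_iUnion.2 ⟨e, he⟩)

theorem isClosed_arc (e : G.edgeSet) : IsClosed (φ.arc e) := by
  obtain ⟨e, he⟩ := e
  induction e with
  | _ u v =>
    obtain ⟨γ, -, hγ⟩ := φ.isArc ⟨s(u, v), he⟩ u v rfl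
    rw [← hγ]
    exact (isCompact_range γ.continuous).isClosed

theorem isClosed_drawing [Finite V] : IsClosed φ.drawing :=
  (Set.finite_range _).isClosed.union (isClosed_iUnion_of_finite φ.isClosed_arc)

theorem isClosed_region [Finite V] : IsClosed (φ.region S) :=
  ((Set.toFinite S).image _).isClosed.union
    ((Set.toFinite _).isClosed_biUnion fun e _ => φ.isClosed_arc e)

theorem point_mem_region_iff : φ.point x ∈ φ.region S ↔ x ∈ S := by
  refine ⟨?_, fun h => Or.inl ⟨x, h, rfl⟩⟩
  rintro (⟨v, hv, hvx⟩ | hp)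
  · exact φ.point_injective hvx ▸ hv
  · simp only [Set.mem_iUnion] at hp
    obtain ⟨e, he, hx⟩ := hp
    exact he x (φ.mem_of_point_mem_arc e x hx)

/-- Distinct arcs meet only in common ends, and an arc contains no vertices other than its ends, so
a common point would yield a common vertex of `S` and `T`. -/
theorem disjoint_region (h : Disjoint S T) : Disjoint (φ.region S) (φ.region T) := by
  rw [Set.disjoint_left]
  rintro p (⟨v, hv, rfl⟩ | hp) hT
  · exact Set.disjoint_left.1 h hv (φ.point_mem_region_iff.1 hT)
  · rcases hT with ⟨v, hv, rfl⟩ | hp'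
    · exact Set.disjoint_left.1 h (φ.point_mem_region_iff.1 (Or.inr hp)) hv
    · simp only [Set.mem_iUnion] at hp hp'
      obtain ⟨e, he, hpe⟩ := hp
      obtain ⟨f, hf, hpf⟩ := hp'
      obtain ⟨u, hu⟩ : ∃ u, u ∈ (e : Sym2 V) := ⟨_, Sym2.out_fst_mem _⟩
      by_cases hef : e = f
      · exact Set.disjoint_left.1 h (he u hu) (hf u (hef ▸ hu))
      · obtain ⟨w, hwe, hwf, -⟩ := φ.arc_inter_arc e f hef p hpe hpf
        exact Set.disjoint_left.1 h (he w hwe) (hf w hwf)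

theorem joinedIn_region (hS : G.ConnOn S) (hx : x ∈ S) (hy : y ∈ S) :
    JoinedIn (φ.region S) (φ.point x) (φ.point y) := by
  refine (hS x hx y hy).induction_on (P := fun z => JoinedIn (φ.region S) (φ.point x) (φ.point z))
    (JoinedIn.refl (φ.point_mem_region_iff.2 hx)) fun p q _ ih hpq => ih.trans ?_
  obtain ⟨hadj, hp, hq⟩ := hpq
  obtain ⟨γ, -, hγ⟩ := φ.isArc ⟨s(p, q), hadj⟩ p q rfl
  refine ⟨γ, fun t => Or.inr ?_⟩
  simp only [Set.mem_iUnion]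
  exact ⟨⟨s(p, q), hadj⟩, by simp [hp, hq], hγ ▸ ⟨t, rfl⟩⟩

/-- The face is open and connected, hence path connected. A small ball around a vertex misses
everything drawn without that vertex and meets the face, because the vertex lies on the frontier.
The connection from `p` to `v` is the face together with this ball. The sets `A v` overlap each
other, which is harmless because all of them are edges at the apex. -/
theorem exists_apex [Finite V] {F : Set EPlane} (hF : φ.IsFace F)
    (hfr : ∀ v, φ.point v ∈ frontier F) :
    ∃ (p : EPlane) (A : V → Set EPlane), (∀ v, JoinedIn (A v) p (φ.point v)) ∧
      ∀ v S, v ∉ S → Disjoint (A v) (φ.region S) := by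
  obtain ⟨p, hp, rfl⟩ := hF
  have hopen : IsOpen (connectedComponentIn φ.drawingᶜ p) :=
    φ.isClosed_drawing.isOpen_compl.connectedComponentIn
  have hpath : IsPathConnected (connectedComponentIn φ.drawingᶜ p) :=
    hopen.isConnected_iff_isPathConnected.1 (isConnected_connectedComponentIn_iff.2 hp)
  have key : ∀ v, ∃ A : Set EPlane, JoinedIn A p (φ.point v) ∧
      ∀ S, v ∉ S → Disjoint A (φ.region S) := by
    intro v
    have hv : φ.point v ∉ φ.region {v}ᶜ := by simp [point_mem_region_iff]
    obtain ⟨ε, hε, hball⟩ := Metric.isOpen_iff.1 φ.isClosed_region.isOpen_compl _ hv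
    obtain ⟨q, hq, hqv⟩ := Metric.mem_closure_iff.1 (frontier_subset_closure (hfr v)) ε hε
    refine ⟨connectedComponentIn φ.drawingᶜ p ∪ Metric.ball (φ.point v) ε, ?_, ?_⟩
    · refine ((hpath.joinedIn p (mem_connectedComponentIn hp) q hq).mono
        Set.subset_union_left).trans (JoinedIn.mono ?_ Set.subset_union_right)
      exact ((convex_ball _ _).isPathConnected ⟨_, Metric.mem_ball_self hε⟩).joinedIn _
        (Metric.mem_ball'.2 hqv) _ (Metric.mem_ball_self hε)
    · intro S hS
      rw [Set.disjoint_union_left]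
      refine ⟨?_, ?_⟩
      · rw [Set.disjoint_left]
        exact fun a ha hb =>
          connectedComponentIn_subset _ _ ha (φ.region_subset_drawing hb)
      · rw [Set.disjoint_left]
        intro a ha hb
        refine hball ha ?_
        rcases hb with ⟨w, hw, rfl⟩ | hb
        · exact Or.inl ⟨w, fun h => hS (h ▸ hw), rfl⟩
        · simp only [Set.mem_iUnion] at hb
          obtain ⟨e, he, hae⟩ := hb
          refine Or.inr ?_
          simp only [Set.mem_iUnion]
          exact ⟨e, fun w hw h => hS (h ▸ he w hw), hae⟩
  choose A hA hA' using key
  exact ⟨p, A, hA, hA'⟩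

end PlanarEmbedding

/-! ### Excluded minors of outerplanar graphs -/

namespace SimpleGraph

variable {V : Type*} {G : SimpleGraph V}

/-- `G` has the complete graph on four vertices as a minor. -/
def HasK4Minor (G : SimpleGraph V) : Prop :=
  ∃ B : Fin 4 → Set V, (∀ i, G.ConnOn (B i)) ∧
    ∀ i j, i ≠ j → Disjoint (B i) (B j) ∧ G.Touch (B i) (B j)

/-- The apex and one vertex of each branch set form a K5: branch sets are connected inside the
region of their union, and the apex reaches each chosen vertex. -/
theorem IsOuterplanar.not_hasK4Minor [Finite V] (hG : G.IsOuterplanar) : ¬ G.HasK4Minor := by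
  rintro ⟨B, hB, hBB⟩
  obtain ⟨φ, F, hF, hfr⟩ := hG
  obtain ⟨p, A, hA, hA'⟩ := φ.exists_apex hF hfr
  have hne : ∀ i, ∃ b, b ∈ B i := by
    intro i
    obtain ⟨j, hj⟩ := exists_ne i
    obtain ⟨x, hx, -⟩ := (hBB i j hj.symm).2
    exact ⟨x, hx⟩
  choose b hb using hne
  -- Index 0 is the apex. The entry `Set.univ` stands on the diagonal and is never used.
  refine not_joined_K5 (P := Fin.cons p fun i => φ.point (b i))
    (R := Fin.cons (Fin.cons Set.univ fun i => A (b i))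
      fun i => Fin.cons (A (b i)) fun j => φ.region (B i ∪ B j)) ?_ ?_
  · intro i j
    refine Fin.cases ?_ (fun i => ?_) i <;> refine Fin.cases ?_ (fun j => ?_) j <;> intro hij
    · exact (hij rfl).elim
    · exact hA _
    · exact (hA _).symm
    · have hij' : i ≠ j := fun h => hij (h ▸ rfl)
      exact φ.joinedIn_region ((hB i).union (hB j) (hBB i j hij').2) (Or.inl (hb i))
        (Or.inr (hb j))
  · have hAd : ∀ i k l, i ≠ k → i ≠ l → Disjoint (A (b i)) (φ.region (B k ∪ B l)) := by
      intro i k l hk hl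
      refine hA' _ _ ?_
      rintro (h | h)
      · exact Set.disjoint_left.1 (hBB i k hk).1 (hb i) h
      · exact Set.disjoint_left.1 (hBB i l hl).1 (hb i) h
    intro i j k l
    refine Fin.cases ?_ (fun i => ?_) i <;> refine Fin.cases ?_ (fun j => ?_) j <;>
      refine Fin.cases ?_ (fun k => ?_) k <;> refine Fin.cases ?_ (fun l => ?_) l <;>
      intro h1 h2 h3 h4 h5 h6 <;> first | exact absurd rfl ‹_› | skip
    all_goals simp only [ne_eq, Fin.succ_inj] at *
    · exact hAd _ _ _ h5 h6
    · exact hAd _ _ _ h3 h4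
    · exact (hAd _ _ _ (Ne.symm h4) (Ne.symm h6)).symm
    · exact (hAd _ _ _ (Ne.symm h3) (Ne.symm h5)).symm
    · refine φ.disjoint_region ?_
      simp only [Set.disjoint_union_left, Set.disjoint_union_right]
      exact ⟨⟨(hBB _ _ h3).1, (hBB _ _ h5).1⟩, (hBB _ _ h4).1, (hBB _ _ h6).1⟩

/-- The apex joins `A` and `B` as the third vertex on their side of a K_{3,3}, with vertices of the
three `C i` on the other side. -/
theorem IsOuterplanar.not_K23_model [Finite V] (hG : G.IsOuterplanar) {A B : Set V}
    {C : Fin 3 → Set V} (hA : G.ConnOn A) (hB : G.ConnOn B) (hC : ∀ i, G.ConnOn (C i))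
    (hAB : Disjoint A B) (hAC : ∀ i, Disjoint A (C i)) (hBC : ∀ i, Disjoint B (C i))
    (hCC : ∀ i j, i ≠ j → Disjoint (C i) (C j)) (tA : ∀ i, G.Touch A (C i))
    (tB : ∀ i, G.Touch B (C i)) : False := by
  obtain ⟨φ, F, hF, hfr⟩ := hG
  obtain ⟨p, R, hR, hR'⟩ := φ.exists_apex hF hfr
  obtain ⟨a, ha, -⟩ := tA 0
  obtain ⟨b, hb, -⟩ := tB 0
  have hne : ∀ i, ∃ c, c ∈ C i := fun i =>
    let ⟨_, _, c, hc, _⟩ := tA i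
    ⟨c, hc⟩
  choose c hc using hne
  have hRd : ∀ j l (D : Set V), j ≠ l → Disjoint D (C j) →
      Disjoint (R (c j)) (φ.region (D ∪ C l)) := by
    intro j l D hjl hD
    refine hR' _ _ ?_
    rintro (h | h)
    · exact Set.disjoint_left.1 hD h (hc j)
    · exact Set.disjoint_left.1 (hCC j l hjl) (hc j) h
  have hABd : ∀ j l, j ≠ l → Disjoint (φ.region (A ∪ C j)) (φ.region (B ∪ C l)) := by
    intro j l hjl
    refine φ.disjoint_region ?_
    simp only [Set.disjoint_union_left, Set.disjoint_union_right]
    exact ⟨⟨hAB, (hBC j).symm⟩, hAC l, hCC j l hjl⟩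
  refine not_joined_K33 (P := ![φ.point a, φ.point b, p]) (Q := fun i => φ.point (c i))
    (R := ![fun j => φ.region (A ∪ C j), fun j => φ.region (B ∪ C j), fun j => R (c j)]) ?_ ?_
  · intro i j
    fin_cases i
    · exact φ.joinedIn_region (hA.union (hC j) (tA j)) (Or.inl ha) (Or.inr (hc j))
    · exact φ.joinedIn_region (hB.union (hC j) (tB j)) (Or.inl hb) (Or.inr (hc j))
    · exact hR _
  · intro i j k l hik hjl
    fin_cases i <;> fin_cases k <;> first | exact absurd rfl hik | skip
    · exact hABd j l hjl
    · exact (hRd l j A hjl.symm (hAC l)).symm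
    · exact (hABd l j hjl.symm).symm
    · exact (hRd l j B hjl.symm (hBC l)).symm
    · exact hRd j l A hjl (hAC j)
    · exact hRd j l B hjl (hBC j)

end SimpleGraph

/-! ### Graphs without K4 minor have vertices of degree at most two -/

namespace SimpleGraph

variable {V : Type*} {G H : SimpleGraph V} {S T : Set V} {r s x y z : V}

theorem ConnOn.mono (h : G.ConnOn S) (hGH : G ≤ H) : H.ConnOn S := fun x hx y hy =>
  (h x hx y hy).mono (within_mono hGH le_rfl)

theorem Touch.mono (h : G.Touch S T) (hGH : G ≤ H) : H.Touch S T :=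
  let ⟨x, hx, y, hy, hxy⟩ := h
  ⟨x, hx, y, hy, hGH hxy⟩

theorem HasK4Minor.mono (h : G.HasK4Minor) (hGH : G ≤ H) : H.HasK4Minor :=
  let ⟨B, hB, hBB⟩ := h
  ⟨B, fun i => (hB i).mono hGH, fun i j hij => ⟨(hBB i j hij).1, (hBB i j hij).2.mono hGH⟩⟩

theorem connOn_singleton (x : V) : G.ConnOn {x} := by
  rintro _ rfl _ rfl
  exact Reachable.refl _

theorem connOn_setOf_reachable (hHG : H ≤ G) (a : V) : G.ConnOn {v | H.Reachable a v} := by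
  have key : ∀ v, H.Reachable a v → (G.within {v | H.Reachable a v}).Reachable a v :=
    fun v hv => hv.induction_on (Reachable.refl _) fun p q hp ih hpq =>
      ih.trans (Adj.reachable ⟨hHG hpq, hp, hp.trans hpq.reachable⟩)
  exact fun x hx y hy => (key x hx).symm.trans (key y hy)

theorem Reachable.mem_of_within (h : (G.within S).Reachable x y) (hx : x ∈ S) : y ∈ S :=
  h.induction_on hx fun _ _ _ _ hpq => hpq.2.2

/-- A walk ending at `z` reaches a neighbour of `z` before it visits `z`. -/
theorem Reachable.exists_adj_last (h : G.Reachable x z) (hxz : x ≠ z) :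
    ∃ q, G.Adj z q ∧ (G.within {z}ᶜ).Reachable x q := by
  have := h.induction_on (P := fun v => (∃ q, G.Adj z q ∧ (G.within {z}ᶜ).Reachable x q) ∨
    (v ≠ z ∧ (G.within {z}ᶜ).Reachable x v)) (Or.inr ⟨hxz, Reachable.refl _⟩) ?_
  · exact this.elim id fun h => (h.1 rfl).elim
  · rintro p q - (hp | ⟨hpz, hp⟩) hpq
    · exact Or.inl hp
    · by_cases hqz : q = z
      · exact Or.inl ⟨p, hqz ▸ hpq.symm, hp⟩
      · exact Or.inr ⟨hqz, hp.trans (Adj.reachable ⟨hpq, hpz, hqz⟩)⟩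

theorem hasK4Minor_of_sets {A B C D : Set V} (hA : G.ConnOn A) (hB : G.ConnOn B)
    (hC : G.ConnOn C) (hD : G.ConnOn D) (hAB : Disjoint A B) (hAC : Disjoint A C)
    (hAD : Disjoint A D) (hBC : Disjoint B C) (hBD : Disjoint B D) (hCD : Disjoint C D)
    (tAB : G.Touch A B) (tAC : G.Touch A C) (tAD : G.Touch A D) (tBC : G.Touch B C)
    (tBD : G.Touch B D) (tCD : G.Touch C D) : G.HasK4Minor := by
  refine ⟨![A, B, C, D], fun i => by fin_cases i <;> assumption, fun i j hij => ?_⟩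
  fin_cases i <;> fin_cases j <;> first
    | exact absurd rfl hij
    | exact ⟨by assumption, by assumption⟩
    | exact ⟨Disjoint.symm (by assumption), Touch.symm (by assumption)⟩

/-- The contraction of the edge `xy` into `y`; the vertex `x` becomes isolated. -/
def contract (G : SimpleGraph V) (x y : V) : SimpleGraph V where
  Adj p q := p ≠ q ∧ p ≠ x ∧ q ≠ x ∧
    (G.Adj p q ∨ (p = y ∧ G.Adj x q) ∨ (q = y ∧ G.Adj x p))
  symm := ⟨fun p q h => ⟨h.1.symm, h.2.2.1, h.2.1, by
    rcases h.2.2.2 with h | h | h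
    · exact Or.inl h.symm
    · exact Or.inr (Or.inr h)
    · exact Or.inr (Or.inl h)⟩⟩
  loopless := ⟨fun _ h => h.1 rfl⟩

open Classical in
/-- The map sending `x` to `y` and fixing the other vertices. -/
noncomputable def merge (x y v : V) : V := if v = x then y else v

theorem merge_self : merge x y x = y := if_pos rfl

theorem merge_of_ne (h : z ≠ x) : merge x y z = z := if_neg h

theorem ConnOn.of_contract (hxy : G.Adj x y) (h : (G.contract x y).ConnOn S) :
    G.ConnOn (merge x y ⁻¹' S) := by
  have hstep : ∀ p q, ((G.contract x y).within S).Adj p q →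
      (G.within (merge x y ⁻¹' S)).Reachable p q := by
    rintro p q ⟨⟨hpq, hpx, hqx, h⟩, hp, hq⟩
    have hp' : p ∈ merge x y ⁻¹' S := by simpa [merge_of_ne hpx] using hp
    have hq' : q ∈ merge x y ⁻¹' S := by simpa [merge_of_ne hqx] using hq
    rcases h with h | ⟨rfl, h⟩ | ⟨rfl, h⟩
    · exact Adj.reachable ⟨by assumption, hp', hq'⟩
    · have hx : x ∈ merge x p ⁻¹' S := by simpa [merge_self] using hp
      exact Reachable.trans (v := x) (Adj.reachable ⟨hxy.symm, hp', hx⟩)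
        (Adj.reachable ⟨by assumption, hx, hq'⟩)
    · have hx : x ∈ merge x q ⁻¹' S := by simpa [merge_self] using hq
      exact Reachable.trans (v := x) (Adj.reachable ⟨Adj.symm (by assumption), hp', hx⟩)
        (Adj.reachable ⟨hxy, hx, hq'⟩)
  have hm : ∀ p ∈ merge x y ⁻¹' S, (G.within (merge x y ⁻¹' S)).Reachable p (merge x y p) := by
    intro p hp
    by_cases hpx : p = x
    · subst hpx
      rw [merge_self]
      exact Adj.reachable ⟨hxy, hp, by simpa [merge_of_ne hxy.ne', merge_self] using hp⟩
    · rw [merge_of_ne hpx]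
  intro p hp q hq
  refine (hm p hp).trans (Reachable.trans ?_ (hm q hq).symm)
  exact (h _ hp _ hq).induction_on (Reachable.refl _) fun a b _ ih hab => ih.trans (hstep a b hab)

theorem Touch.of_contract (hxy : G.Adj x y) (h : (G.contract x y).Touch S T) :
    G.Touch (merge x y ⁻¹' S) (merge x y ⁻¹' T) := by
  obtain ⟨p, hp, q, hq, hpq, hpx, hqx, h⟩ := h
  have hp' : p ∈ merge x y ⁻¹' S := by simpa [merge_of_ne hpx] using hp
  have hq' : q ∈ merge x y ⁻¹' T := by simpa [merge_of_ne hqx] using hq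
  rcases h with h | ⟨rfl, h⟩ | ⟨rfl, h⟩
  · exact ⟨p, hp', q, hq', h⟩
  · exact ⟨x, by simpa [merge_self] using hp, q, hq', h⟩
  · exact ⟨p, hp', x, by simpa [merge_self] using hq, h.symm⟩

theorem HasK4Minor.of_contract (hxy : G.Adj x y) (h : (G.contract x y).HasK4Minor) :
    G.HasK4Minor :=
  let ⟨B, hB, hBB⟩ := h
  ⟨fun i => merge x y ⁻¹' B i, fun i => (hB i).of_contract hxy, fun i j hij =>
    ⟨(hBB i j hij).1.preimage _, (hBB i j hij).2.of_contract hxy⟩⟩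

theorem support_contract_subset (hxy : G.Adj x y) :
    (G.contract x y).support ⊆ G.support \ {x} := by
  rintro p ⟨q, hpq, hpx, hqx, h | ⟨rfl, h⟩ | ⟨rfl, h⟩⟩
  · exact ⟨⟨q, h⟩, hpx⟩
  · exact ⟨⟨x, hxy.symm⟩, hpx⟩
  · exact ⟨⟨x, h.symm⟩, hpx⟩

theorem ncard_pair_le (a b : V) : ({a, b} : Set V).ncard ≤ 2 :=
  (Set.ncard_insert_le a {b}).trans (by simp)

variable [Finite V]

/-- If `z` and `z'` are connected off `x` and `y`, the sets `{x}`, `{y}`, `{z}` and what `z'`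
reaches without them form a K4. Otherwise `{x, y}` separates `z` from `z'`, the adjacent vertices
`r` and `s` cannot lie on different sides, and induction applies to a side free of both, with `x`
and `y` as the new exceptional pair. -/
theorem hasK4Minor_of_two_common_adj (hrs : G.Adj r s)
    (hdeg : ∀ v ∈ G.support, v ≠ r → v ≠ s → 3 ≤ (G.neighborSet v).ncard)
    (ih : ∀ (G' : SimpleGraph V) (r' s' : V), G'.support.ncard < G.support.ncard →
      G'.Adj r' s' → (∃ t ∈ G'.support, t ≠ r' ∧ t ≠ s') →
      (∀ v ∈ G'.support, v ≠ r' → v ≠ s' → 3 ≤ (G'.neighborSet v).ncard) → G'.HasK4Minor)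
    (hxy : G.Adj x y) {z z' : V} (hxz : G.Adj x z) (hyz : G.Adj y z) (hxz' : G.Adj x z')
    (hyz' : G.Adj y z') (hne : z ≠ z') : G.HasK4Minor := by
  have hmem : ∀ {w}, G.Adj x w → G.Adj y w → w ∈ ({x, y} : Set V)ᶜ := fun h h' => by
    simp [h.ne', h'.ne']
  by_cases hreach : (G.within {x, y}ᶜ).Reachable z' z
  · obtain ⟨q, hq, hzq⟩ := hreach.exists_adj_last hne.symm
    have hD : ∀ v, ((G.within {x, y}ᶜ).within {z}ᶜ).Reachable z' v → v ≠ x ∧ v ≠ y ∧ v ≠ z := by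
      intro v hv
      have h1 := (hv.mono within_le).mem_of_within (hmem hxz' hyz')
      have h2 := hv.mem_of_within (Ne.symm hne : z' ≠ z)
      simp only [Set.mem_compl_iff, Set.mem_insert_iff, Set.mem_singleton_iff, not_or] at h1 h2
      exact ⟨h1.1, h1.2, h2⟩
    refine hasK4Minor_of_sets (connOn_singleton x) (connOn_singleton y) (connOn_singleton z)
      (connOn_setOf_reachable (within_le.trans within_le) z') (by simp [hxy.ne])
      (by simp [hxz.ne]) ?_ (by simp [hyz.ne]) ?_ ?_ ⟨x, rfl, y, rfl, hxy⟩ ⟨x, rfl, z, rfl, hxz⟩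
      ⟨x, rfl, z', Reachable.refl _, hxz'⟩ ⟨y, rfl, z, rfl, hyz⟩
      ⟨y, rfl, z', Reachable.refl _, hyz'⟩ ⟨z, rfl, q, hzq, hq.1⟩
    · exact Set.disjoint_singleton_left.2 fun h => (hD _ h).1 rfl
    · exact Set.disjoint_singleton_left.2 fun h => (hD _ h).2.1 rfl
    · exact Set.disjoint_singleton_left.2 fun h => (hD _ h).2.2 rfl
  · have aux : ∀ z z', G.Adj x z → G.Adj y z → G.Adj x z' → G.Adj y z' →
        ¬ (G.within {x, y}ᶜ).Reachable z z' → ¬ (G.within {x, y}ᶜ).Reachable z r →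
        ¬ (G.within {x, y}ᶜ).Reachable z s → G.HasK4Minor := by
      intro z z' hxz hyz hxz' hyz' hzz' hzr hzs
      set D : Set V := {v | (G.within {x, y}ᶜ).Reachable z v} ∪ {x, y} with hDdef
      have hx : x ∈ D := Or.inr (by simp)
      have hy : y ∈ D := Or.inr (by simp)
      have hz : z ∈ D := Or.inl (Reachable.refl _)
      have hz' : z' ∉ D := by
        rintro (h | h)
        · exact hzz' h
        · exact hmem hxz' hyz' h
      refine (ih (G.within D) x y ?_ ⟨hxy, hx, hy⟩
        ⟨z, ⟨x, hxz.symm, hz, hx⟩, hxz.ne', hyz.ne'⟩ ?_).mono within_le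
      · refine Set.ncard_lt_ncard ⟨fun a ⟨b, hab⟩ => ⟨b, hab.1⟩, fun h => ?_⟩ (Set.toFinite _)
        obtain ⟨b, hb⟩ := h (show z' ∈ G.support from ⟨x, hxz'.symm⟩)
        exact hz' hb.2.1
      · rintro v ⟨b, hb⟩ hvx hvy
        have hv : (G.within {x, y}ᶜ).Reachable z v := by
          rcases hb.2.1 with h | h
          · exact h
          · exact absurd h (by simp [hvx, hvy])
        refine (hdeg v ⟨b, hb.1⟩ (fun h => hzr (h ▸ hv)) (fun h => hzs (h ▸ hv))).trans
          (Set.ncard_le_ncard (fun q hq => ⟨hq, hb.2.1, ?_⟩) (Set.toFinite _))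
        by_cases hq' : q ∈ ({x, y} : Set V)
        · exact Or.inr hq'
        · exact Or.inl (hv.trans (Adj.reachable ⟨hq, by simp [hvx, hvy], hq'⟩))
    have hrs' : ∀ {w w'}, G.Adj x w → G.Adj y w → G.Adj x w' → G.Adj y w' →
        (G.within {x, y}ᶜ).Reachable w r → (G.within {x, y}ᶜ).Reachable w' s →
        (G.within {x, y}ᶜ).Reachable w w' := fun h1 h2 h3 h4 hr hs =>
      (hr.trans (Adj.reachable ⟨hrs, hr.mem_of_within (hmem h1 h2),
        hs.mem_of_within (hmem h3 h4)⟩)).trans hs.symm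
    by_cases h1 : (G.within {x, y}ᶜ).Reachable z r ∨ (G.within {x, y}ᶜ).Reachable z s
    · refine aux z' z hxz' hyz' hxz hyz hreach (fun h => ?_) (fun h => ?_)
      · rcases h1 with h1 | h1
        · exact hreach (h.trans h1.symm)
        · exact hreach (hrs' hxz' hyz' hxz hyz h h1)
      · rcases h1 with h1 | h1
        · exact hreach (hrs' hxz hyz hxz' hyz' h1 h).symm
        · exact hreach (h.trans h1.symm)
    · exact aux z z' hxz hyz hxz' hyz' (fun h => hreach h.symm) (fun h => h1 (Or.inl h))
        (fun h => h1 (Or.inr h))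

/-- Contracting `xy` lowers only the degrees of common neighbours, each by one, so the degree
hypothesis survives when these have degree at least 4 or are exceptional. -/
theorem hasK4Minor_of_contract_edge (hrs : G.Adj r s)
    (hdeg : ∀ v ∈ G.support, v ≠ r → v ≠ s → 3 ≤ (G.neighborSet v).ncard)
    (ih : ∀ (G' : SimpleGraph V) (r' s' : V), G'.support.ncard < G.support.ncard →
      G'.Adj r' s' → (∃ t ∈ G'.support, t ≠ r' ∧ t ≠ s') →
      (∀ v ∈ G'.support, v ≠ r' → v ≠ s' → 3 ≤ (G'.neighborSet v).ncard) → G'.HasK4Minor)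
    (hxy : G.Adj x y) (hxr : x ≠ r) (hxs : x ≠ s)
    (hcommon : ∀ t, G.Adj x t → G.Adj y t → t ≠ r → t ≠ s → 4 ≤ (G.neighborSet t).ncard) :
    G.HasK4Minor := by
  by_cases htwo : ∃ z z', z ≠ z' ∧ G.Adj x z ∧ G.Adj y z ∧ G.Adj x z' ∧ G.Adj y z'
  · obtain ⟨z, z', hne, h1, h2, h3, h4⟩ := htwo
    exact hasK4Minor_of_two_common_adj hrs hdeg ih hxy h1 h2 h3 h4 hne
  have hinter : (G.neighborSet x ∩ G.neighborSet y).ncard ≤ 1 := by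
    rw [Set.ncard_le_one]
    intro a ha b hb
    by_contra hab
    exact htwo ⟨a, b, hab, ha.1, ha.2, hb.1, hb.2⟩
  have hx3 : 3 ≤ (G.neighborSet x).ncard := hdeg x ⟨y, hxy⟩ hxr hxs
  have hpair : ∀ a b : V, ({a, b} : Set V).ncard ≤ 2 := ncard_pair_le
  refine HasK4Minor.of_contract hxy (ih (G.contract x y) r s ?_ ?_ ?_ ?_)
  · refine Set.ncard_lt_ncard ⟨fun a ha => (support_contract_subset hxy ha).1, fun h => ?_⟩
      (Set.toFinite _)
    exact (support_contract_subset hxy (h ⟨y, hxy⟩)).2 rfl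
  · exact ⟨hrs.ne, hxr.symm, hxs.symm, Or.inl hrs⟩
  · obtain ⟨t, ht, ht'⟩ : ∃ t ∈ G.neighborSet x, t ∉ ({r, s} : Set V) :=
      Set.exists_mem_notMem_of_ncard_lt_ncard (by have := hpair r s; omega)
    simp only [Set.mem_insert_iff, Set.mem_singleton_iff, not_or] at ht'
    by_cases hty : t = y
    · subst hty
      obtain ⟨q, hq, hq'⟩ : ∃ q ∈ G.neighborSet x, q ∉ ({t} : Set V) :=
        Set.exists_mem_notMem_of_ncard_lt_ncard (by simp; omega)
      exact ⟨t, ⟨q, Ne.symm hq', hxy.ne', hq.ne', Or.inr (Or.inl ⟨rfl, hq⟩)⟩, ht'⟩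
    · exact ⟨t, ⟨y, hty, ht.ne', hxy.ne', Or.inr (Or.inr ⟨rfl, ht⟩)⟩, ht'⟩
  · intro v hv hvr hvs
    obtain ⟨hv, hvx⟩ := support_contract_subset hxy hv
    have hv3 := hdeg v hv hvr hvs
    by_cases hvy : v = y
    · subst hvy
      have hsub : (G.neighborSet x ∪ G.neighborSet v) \ {x, v} ⊆
          (G.contract x v).neighborSet v := by
        rintro q ⟨hq, hq'⟩
        simp only [Set.mem_insert_iff, Set.mem_singleton_iff, not_or] at hq'
        refine ⟨Ne.symm hq'.2, hvx, hq'.1, ?_⟩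
        exact hq.elim (fun h => Or.inr (Or.inl ⟨rfl, h⟩)) Or.inl
      -- At most one neighbour is shared, so the union has at least 3 + 3 - 1 = 5 elements, and 3
      -- remain without the two ends.
      have h1 := Set.ncard_union_add_ncard_inter (G.neighborSet x) (G.neighborSet v)
      have h2 := Set.ncard_le_ncard hsub (Set.toFinite _)
      have h3 := Set.ncard_le_ncard_sdiff_add_ncard (G.neighborSet x ∪ G.neighborSet v) {x, v}
        (Set.toFinite _)
      have h4 := hpair x v
      omega
    · have hsub : G.neighborSet v \ {x} ⊆ (G.contract x y).neighborSet v := fun q hq =>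
        ⟨hq.1.ne, hvx, hq.2, Or.inl hq.1⟩
      by_cases hxv : G.Adj x v
      · have hy : y ∈ (G.contract x y).neighborSet v :=
          ⟨hvy, hvx, hxy.ne', Or.inr (Or.inr ⟨rfl, hxv⟩)⟩
        have h1 := Set.ncard_sdiff_singleton_add_one (show x ∈ G.neighborSet v from hxv.symm)
          (Set.toFinite _)
        by_cases hyv : G.Adj y v
        · have := hcommon v hxv hyv hvr hvs
          have := Set.ncard_le_ncard hsub (Set.toFinite _)
          omega
        · have h2 := Set.ncard_le_ncard (Set.insert_subset hy hsub) (Set.toFinite _)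
          rw [Set.ncard_insert_of_notMem (fun h => hyv h.1.symm) (Set.toFinite _)] at h2
          omega
      · have h2 := Set.ncard_le_ncard hsub (Set.toFinite _)
        rw [Set.sdiff_singleton_eq_self (fun h => hxv h.symm)] at h2
        omega

/-- In a minimal counterexample every edge with an end outside `{r, s}` has a common neighbour of
degree 3 outside `{r, s}`. Let `t` be one for `xy`, with third neighbour `q`. The edge `tq` also has
a common neighbour, which must be `x` or `y`. If it is `x`, the edge `tx` has the two common
neighbours `y` and `q`, which is already excluded; the case of `y` is symmetric. The exceptional
pair is there for the separation step of the induction. -/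
theorem hasK4Minor_of_degree (G : SimpleGraph V) (r s : V) (hrs : G.Adj r s)
    (hex : ∃ t ∈ G.support, t ≠ r ∧ t ≠ s)
    (hdeg : ∀ v ∈ G.support, v ≠ r → v ≠ s → 3 ≤ (G.neighborSet v).ncard) :
    G.HasK4Minor := by
  induction hn : G.support.ncard using Nat.strong_induction_on generalizing G r s with
  | _ n ih =>
  replace ih : ∀ (G' : SimpleGraph V) (r' s' : V), G'.support.ncard < G.support.ncard →
      G'.Adj r' s' → (∃ t ∈ G'.support, t ≠ r' ∧ t ≠ s') →
      (∀ v ∈ G'.support, v ≠ r' → v ≠ s' → 3 ≤ (G'.neighborSet v).ncard) → G'.HasK4Minor :=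
    fun G' r' s' hlt h1 h2 h3 => ih _ (hn ▸ hlt) G' r' s' h1 h2 h3 rfl
  obtain ⟨x, ⟨y, hxy⟩, hxr, hxs⟩ := hex
  by_contra hK
  have htwo : ∀ {x y z z'}, G.Adj x y → G.Adj x z → G.Adj y z → G.Adj x z' → G.Adj y z' →
      z = z' := fun h1 h2 h3 h4 h5 => by
    by_contra hne
    exact hK (hasK4Minor_of_two_common_adj hrs hdeg ih h1 h2 h3 h4 h5 hne)
  have hbad : ∀ {x y}, G.Adj x y → x ≠ r → x ≠ s →
      ∃ t, G.Adj x t ∧ G.Adj y t ∧ t ≠ r ∧ t ≠ s ∧ (G.neighborSet t).ncard ≤ 3 := by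
    intro x y hxy hxr hxs
    by_contra hno
    push Not at hno
    exact hK (hasK4Minor_of_contract_edge hrs hdeg ih hxy hxr hxs hno)
  obtain ⟨t, hxt, hyt, htr, hts, ht3⟩ := hbad hxy hxr hxs
  have ht := hdeg t ⟨x, hxt.symm⟩ htr hts
  obtain ⟨q, hq, hq'⟩ : ∃ q ∈ G.neighborSet t, q ∉ ({x, y} : Set V) :=
    Set.exists_mem_notMem_of_ncard_lt_ncard (by have := ncard_pair_le x y; omega)
  simp only [Set.mem_insert_iff, Set.mem_singleton_iff, not_or] at hq'
  obtain ⟨t', htt', hqt', -⟩ := hbad hq htr hts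
  have hN : ({q, x, y} : Set V) = G.neighborSet t := by
    refine Set.eq_of_subset_of_ncard_le ?_ ?_ (Set.toFinite _)
    · rintro a (rfl | rfl | rfl)
      exacts [hq, hxt.symm, hyt.symm]
    · rw [Set.ncard_insert_of_notMem (by simpa using hq'), Set.ncard_pair hxy.ne]
      exact ht3
  have hmem : t' ∈ ({q, x, y} : Set V) := hN ▸ htt'
  rcases hmem with rfl | rfl | rfl
  · exact hqt'.ne rfl
  · exact hq'.2 (htwo hxt.symm hyt.symm hxy hq hqt'.symm).symm
  · exact hq'.1 (htwo hyt.symm hxt.symm hxy.symm hq hqt'.symm).symm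

theorem exists_degree_le_two (hK : ¬ G.HasK4Minor) (hne : G ≠ ⊥) (r : V) :
    ∃ v ∈ G.support, v ≠ r ∧ (G.neighborSet v).ncard ≤ 2 := by
  obtain ⟨r', s', hrs', hr⟩ : ∃ r' s', G.Adj r' s' ∧ (r ∈ G.support → r = r') := by
    by_cases hr : r ∈ G.support
    · obtain ⟨s, hs⟩ := hr
      exact ⟨r, s, hs, fun _ => rfl⟩
    · obtain ⟨a, b, hab⟩ := ne_bot_iff_exists_adj.1 hne
      exact ⟨a, b, hab, fun h => (hr h).elim⟩
  by_contra hno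
  push Not at hno
  have hdeg : ∀ v ∈ G.support, v ≠ r' → 3 ≤ (G.neighborSet v).ncard := fun v hv hvr =>
    hno v hv fun h => hvr (h ▸ hr (h ▸ hv))
  obtain ⟨t, ht, ht'⟩ : ∃ t ∈ G.neighborSet s', t ∉ ({r'} : Set V) :=
    Set.exists_mem_notMem_of_ncard_lt_ncard (by
      have := hdeg s' ⟨r', hrs'.symm⟩ hrs'.ne'
      simp; omega)
  exact hK (hasK4Minor_of_degree G r' s' hrs' ⟨t, ⟨s', ht.symm⟩, ht', ht.ne'⟩
    fun v hv h _ => hdeg v hv h)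

end SimpleGraph

/-! ### Models of K_{2,3} -/

namespace SimpleGraph

variable {V : Type*} {G H : SimpleGraph V} {A B S T : Set V} {C : ℕ → Set V} {s : ℕ}
  {u t v x y z : V}

/-- Two disjoint connected sets `A` and `B`, and `3 - s` further disjoint connected sets that touch
both of them. -/
structure IsK23Model (G : SimpleGraph V) (A B : Set V) (C : ℕ → Set V) (s : ℕ) : Prop where
  connLeft : G.ConnOn A
  connRight : G.ConnOn B
  disj : Disjoint A B
  conn : ∀ i, s ≤ i → i < 3 → G.ConnOn (C i)
  disjLeft : ∀ i, s ≤ i → i < 3 → Disjoint A (C i)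
  disjRight : ∀ i, s ≤ i → i < 3 → Disjoint B (C i)
  touchLeft : ∀ i, s ≤ i → i < 3 → G.Touch A (C i)
  touchRight : ∀ i, s ≤ i → i < 3 → G.Touch B (C i)
  pairwise : ∀ i j, s ≤ i → i < 3 → s ≤ j → j < 3 → i ≠ j → Disjoint (C i) (C j)

theorem IsK23Model.mono (h : G.IsK23Model A B C s) (hGH : G ≤ H) : H.IsK23Model A B C s :=
  ⟨h.1.mono hGH, h.2.mono hGH, h.3, fun i h1 h2 => (h.4 i h1 h2).mono hGH, h.5, h.6,
    fun i h1 h2 => (h.7 i h1 h2).mono hGH, fun i h1 h2 => (h.8 i h1 h2).mono hGH, h.9⟩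

theorem IsK23Model.of_contract (hxy : G.Adj x y) (h : (G.contract x y).IsK23Model A B C s) :
    G.IsK23Model (merge x y ⁻¹' A) (merge x y ⁻¹' B) (fun i => merge x y ⁻¹' C i) s :=
  ⟨h.1.of_contract hxy, h.2.of_contract hxy, h.3.preimage _,
    fun i h1 h2 => (h.4 i h1 h2).of_contract hxy, fun i h1 h2 => (h.5 i h1 h2).preimage _,
    fun i h1 h2 => (h.6 i h1 h2).preimage _, fun i h1 h2 => (h.7 i h1 h2).of_contract hxy,
    fun i h1 h2 => (h.8 i h1 h2).of_contract hxy,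
    fun i j h1 h2 h3 h4 h5 => (h.9 i j h1 h2 h3 h4 h5).preimage _⟩

theorem ConnOn.of_within (h : (G.within T).ConnOn S) : G.ConnOn (S ∩ T) := by
  have hle : (G.within T).within S ≤ G.within (S ∩ T) := fun _ _ hab =>
    ⟨hab.1.1, ⟨hab.2.1, hab.1.2.1⟩, hab.2.2, hab.1.2.2⟩
  exact fun x hx y hy => (h x hx.1 y hy.1).mono hle

theorem Touch.of_within {R : Set V} (h : (G.within T).Touch S R) : G.Touch (S ∩ T) (R ∩ T) :=
  let ⟨x, hx, y, hy, hxy⟩ := h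
  ⟨x, ⟨hx, hxy.2.1⟩, y, ⟨hy, hxy.2.2⟩, hxy.1⟩

theorem IsK23Model.of_within (h : (G.within T).IsK23Model A B C s) :
    G.IsK23Model (A ∩ T) (B ∩ T) (fun i => C i ∩ T) s :=
  have hd : ∀ {S R : Set V}, Disjoint S R → Disjoint (S ∩ T) (R ∩ T) := fun h =>
    h.mono Set.inter_subset_left Set.inter_subset_left
  ⟨h.1.of_within, h.2.of_within, hd h.3, fun i h1 h2 => (h.4 i h1 h2).of_within,
    fun i h1 h2 => hd (h.5 i h1 h2), fun i h1 h2 => hd (h.6 i h1 h2),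
    fun i h1 h2 => (h.7 i h1 h2).of_within, fun i h1 h2 => (h.8 i h1 h2).of_within,
    fun i j h1 h2 h3 h4 h5 => hd (h.9 i j h1 h2 h3 h4 h5)⟩

/-- A single vertex adjacent to both sides fills the free slot `s`; this trades one unit of the
required edge weight for an explicit connector. -/
theorem IsK23Model.add_connector (h : G.IsK23Model A B C (s + 1)) {v : V} (hA : v ∉ A)
    (hB : v ∉ B) (hC : ∀ i, v ∉ C i) (tA : ∃ a ∈ A, G.Adj a v) (tB : ∃ b ∈ B, G.Adj b v) :
    G.IsK23Model A B (Function.update C s {v}) s := by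
  have key : ∀ (P : ℕ → Set V → Prop), P s {v} → (∀ i, s + 1 ≤ i → i < 3 → P i (C i)) →
      ∀ i, s ≤ i → i < 3 → P i (Function.update C s {v} i) := by
    intro P h1 h2 i hi hi3
    rcases hi.eq_or_lt with rfl | hlt
    · simpa using h1
    · rw [Function.update_of_ne hlt.ne']
      exact h2 i hlt hi3
  obtain ⟨a, ha, hav⟩ := tA
  obtain ⟨b, hb, hbv⟩ := tB
  refine ⟨h.1, h.2, h.3, key (fun _ D => G.ConnOn D) (connOn_singleton v) h.4,
    key (fun _ D => Disjoint A D) (by simpa using hA) h.5,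
    key (fun _ D => Disjoint B D) (by simpa using hB) h.6,
    key (fun _ D => G.Touch A D) ⟨a, ha, v, rfl, hav⟩ h.7,
    key (fun _ D => G.Touch B D) ⟨b, hb, v, rfl, hbv⟩ h.8, ?_⟩
  intro i j hi hi3 hj hj3 hij
  refine key (fun i D => i ≠ j → Disjoint D (Function.update C s {v} j)) (fun hne => ?_)
    (fun i hi hi3 hne => ?_) i hi hi3 hij
  · rw [Function.update_of_ne hne.symm]
    simpa using hC j
  · exact key (fun j D => i ≠ j → Disjoint (C i) D) (fun _ => by simpa using hC i)
      (fun j hj hj3 hne => h.9 i j hi hi3 hj hj3 hne) j hj hj3 hne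

end SimpleGraph

/-! ### Weighted graphs and their reductions -/

/-- A weighted graph: weight `0` stands for a missing edge. An edge of weight `m` stands for an edge
together with `m - 1` vertices of degree two joined to both of its ends. -/
structure WGraph (V : Type*) where
  /-- the weight of a pair of vertices -/
  w : V → V → ℕ
  symm : ∀ x y, w x y = w y x
  irrefl : ∀ x, w x x = 0

namespace WGraph

open SimpleGraph

variable {V : Type*} {M M' : WGraph V} {S : Set V} {u t v x y z : V} {k : ℕ}

/-- The underlying simple graph. -/
def graph (M : WGraph V) : SimpleGraph V where
  Adj x y := M.w x y ≠ 0
  symm := ⟨fun x y h => by rwa [M.symm y x]⟩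
  loopless := ⟨fun x h => h (M.irrefl x)⟩

theorem ne_of_w (h : M.w x y ≠ 0) : x ≠ y := Adj.ne (G := M.graph) h

/-- Three connections between two disjoint connected sets, where an edge of weight `m` counts for
`m - 1` connections. -/
def HasK23 (M : WGraph V) : Prop :=
  ∃ A B C s, M.graph.IsK23Model A B C s ∧ (s = 0 ∨ ∃ a ∈ A, ∃ b ∈ B, s < M.w a b)

theorem graph_mono (h : ∀ x y, M.w x y ≤ M'.w x y) : M.graph ≤ M'.graph := fun x y hxy h0 =>
  hxy (Nat.le_zero.1 (h0 ▸ h x y))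

theorem HasK23.mono (hM : M.HasK23) (h : ∀ x y, M.w x y ≤ M'.w x y) : M'.HasK23 := by
  obtain ⟨A, B, C, s, hmod, hs⟩ := hM
  refine ⟨A, B, C, s, hmod.mono (graph_mono h), hs.imp_right ?_⟩
  rintro ⟨a, ha, b, hb, hab⟩
  exact ⟨a, ha, b, hb, hab.trans_le (h a b)⟩

open Classical in
/-- The edges with both ends in `S`. -/
noncomputable def within (M : WGraph V) (S : Set V) : WGraph V where
  w x y := if x ∈ S ∧ y ∈ S then M.w x y else 0
  symm x y := by simp only [and_comm, M.symm x y]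
  irrefl x := by simp [M.irrefl]

open Classical in
/-- The edges with an end outside `S`. -/
noncomputable def outside (M : WGraph V) (S : Set V) : WGraph V where
  w x y := if x ∈ S ∧ y ∈ S then 0 else M.w x y
  symm x y := by simp only [and_comm, M.symm x y]
  irrefl x := by simp [M.irrefl]

open Classical in
/-- Remove the edges at `v` and give the pair `ut` the weight `k`. -/
noncomputable def reduce (M : WGraph V) (v u t : V) (k : ℕ) : WGraph V where
  w x y := if x = y ∨ x = v ∨ y = v then 0 else
    if (x = u ∧ y = t) ∨ (x = t ∧ y = u) then k else M.w x y
  symm x y := by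
    have h1 : (x = y ∨ x = v ∨ y = v) ↔ (y = x ∨ y = v ∨ x = v) := by tauto
    have h2 : ((x = u ∧ y = t) ∨ (x = t ∧ y = u)) ↔ ((y = u ∧ x = t) ∨ (y = t ∧ x = u)) := by
      tauto
    simp only [h1, h2, M.symm x y]
  irrefl x := by simp

theorem within_w_le (x y : V) : (M.within S).w x y ≤ M.w x y := by
  simp only [within]
  split_ifs <;> simp

theorem within_w_of_mem (hx : x ∈ S) (hy : y ∈ S) : (M.within S).w x y = M.w x y :=
  if_pos ⟨hx, hy⟩

theorem mem_of_within_w (h : (M.within S).w x y ≠ 0) : x ∈ S ∧ y ∈ S := by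
  by_contra hn
  exact h (if_neg hn)

theorem reduce_w_left : (M.reduce v u t k).w v x = 0 := by simp [reduce]

theorem reduce_w_right : (M.reduce v u t k).w x v = 0 := by simp [reduce]

theorem reduce_w_pair (hu : u ≠ v) (ht : t ≠ v) (hut : u ≠ t) : (M.reduce v u t k).w u t = k := by
  simp [reduce, hu, ht, hut]

theorem reduce_w (hx : x ≠ v) (hy : y ≠ v) (h : ¬ (x = u ∧ y = t)) (h' : ¬ (x = t ∧ y = u)) :
    (M.reduce v u t k).w x y = M.w x y := by
  by_cases hxy : x = y
  · subst hxy
    rw [WGraph.irrefl, WGraph.irrefl]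
  · simp only [reduce]
    rw [if_neg (by tauto), if_neg (by tauto)]

theorem reduce_graph_le (ht : M.w v t ≠ 0) :
    (M.reduce v u t k).graph ≤ M.graph.contract v u := by
  intro x y hxy
  have hxv : x ≠ v := fun h => hxy (h ▸ reduce_w_left)
  have hyv : y ≠ v := fun h => hxy (h ▸ reduce_w_right)
  refine ⟨hxy.ne, hxv, hyv, ?_⟩
  by_cases h : x = u ∧ y = t
  · exact Or.inr (Or.inl ⟨h.1, h.2 ▸ ht⟩)
  by_cases h' : x = t ∧ y = u
  · exact Or.inr (Or.inr ⟨h'.2, h'.1 ▸ ht⟩)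
  · refine Or.inl ?_
    change (M.reduce v u t k).w x y ≠ 0 at hxy
    rwa [reduce_w hxv hyv h h'] at hxy

theorem reduce_comm : M.reduce v u t k = M.reduce v t u k := by
  simp only [reduce, WGraph.mk.injEq]
  funext x y
  split_ifs <;> first | rfl | (exfalso; tauto)

/-- The reduced graph is contained in a contraction of `v` into either neighbour. If the model uses
the weight of the new edge, the lighter of the two old edges is the one to contract, so that the
heavier one still joins `A` to `B`. -/
theorem HasK23.of_reduce_series (hu : M.w v u ≠ 0) (ht : M.w v t ≠ 0) (hut : u ≠ t)
    (h : (M.reduce v u t (max (M.w v u) (M.w v t))).HasK23) : M.HasK23 := by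
  obtain ⟨A, B, C, s, hmod, hs⟩ := h
  have huv := (ne_of_w hu).symm
  have htv := (ne_of_w ht).symm
  have hle : ∀ y, y = u ∨ y = t → M.graph.Adj v y ∧
      (M.reduce v u t (max (M.w v u) (M.w v t))).graph ≤ M.graph.contract v y := by
    rintro y (rfl | rfl)
    · exact ⟨hu, reduce_graph_le ht⟩
    · exact ⟨ht, reduce_comm (M := M) ▸ reduce_graph_le hu⟩
  have key : ∀ y, y = u ∨ y = t → (s = 0 ∨ ∃ a ∈ merge v y ⁻¹' A, ∃ b ∈ merge v y ⁻¹' B,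
      s < M.w a b) → M.HasK23 := fun y hy hs' =>
    ⟨_, _, _, s, (hmod.mono (hle y hy).2).of_contract (hle y hy).1, hs'⟩
  rcases hs with hs | ⟨a, ha, b, hb, hab⟩
  · exact key u (Or.inl rfl) (Or.inl hs)
  have h0 : (M.reduce v u t (max (M.w v u) (M.w v t))).w a b ≠ 0 := by omega
  have hav : a ≠ v := fun h => h0 (h ▸ reduce_w_left)
  have hbv : b ≠ v := fun h => h0 (h ▸ reduce_w_right)
  have hm : ∀ {y c} {D : Set V}, c ≠ v → c ∈ D → c ∈ merge v y ⁻¹' D := fun hc hD => by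
    simpa [merge_of_ne hc] using hD
  have hm' : ∀ {y} {D : Set V}, y ∈ D → v ∈ merge v y ⁻¹' D := fun hD => by
    simpa [merge_self] using hD
  by_cases h : a = u ∧ b = t
  · obtain ⟨rfl, rfl⟩ := h
    rw [reduce_w_pair huv htv hut, lt_max_iff] at hab
    rcases hab with hab | hab
    · exact key b (Or.inr rfl) (Or.inr ⟨a, hm hav ha, v, hm' hb, M.symm v a ▸ hab⟩)
    · exact key a (Or.inl rfl) (Or.inr ⟨v, hm' ha, b, hm hbv hb, hab⟩)
  by_cases h' : a = t ∧ b = u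
  · obtain ⟨rfl, rfl⟩ := h'
    rw [WGraph.symm, reduce_w_pair huv htv hut, lt_max_iff] at hab
    rcases hab with hab | hab
    · exact key a (Or.inr rfl) (Or.inr ⟨v, hm' ha, b, hm hbv hb, hab⟩)
    · exact key b (Or.inl rfl) (Or.inr ⟨a, hm hav ha, v, hm' hb, M.symm v a ▸ hab⟩)
  · rw [reduce_w hav hbv h h'] at hab
    exact key u (Or.inl rfl) (Or.inr ⟨a, hm hav ha, b, hm hbv hb, hab⟩)

theorem reduce_graph_le_within (hw : M.w u t ≠ 0) :
    (M.reduce v u t k).graph ≤ M.graph.within {v}ᶜ := by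
  intro x y hxy
  have hxv : x ≠ v := fun h => hxy (h ▸ reduce_w_left)
  have hyv : y ≠ v := fun h => hxy (h ▸ reduce_w_right)
  refine ⟨?_, hxv, hyv⟩
  by_cases h : x = u ∧ y = t
  · obtain ⟨rfl, rfl⟩ := h
    exact hw
  by_cases h' : x = t ∧ y = u
  · obtain ⟨rfl, rfl⟩ := h'
    exact Adj.symm (G := M.graph) hw
  · change (M.reduce v u t k).w x y ≠ 0 at hxy
    rwa [reduce_w hxv hyv h h'] at hxy

/-- The extra unit of weight on `ut` is `v` itself: when the model uses that edge, `v` becomes an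
explicit connector. -/
theorem HasK23.of_reduce_parallel (hu : M.w v u ≠ 0) (ht : M.w v t ≠ 0) (hw : M.w u t ≠ 0)
    (h : (M.reduce v u t (M.w u t + 1)).HasK23) : M.HasK23 := by
  obtain ⟨A, B, C, s, hmod, hs⟩ := h
  have huv := (ne_of_w hu).symm
  have htv := (ne_of_w ht).symm
  replace hmod := (hmod.mono (reduce_graph_le_within hw)).of_within
  rcases hs with hs | ⟨a, ha, b, hb, hab⟩
  · exact ⟨_, _, _, s, hmod, Or.inl hs⟩
  have h0 : (M.reduce v u t (M.w u t + 1)).w a b ≠ 0 := by omega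
  have hav : a ≠ v := fun h => h0 (h ▸ reduce_w_left)
  have hbv : b ≠ v := fun h => h0 (h ▸ reduce_w_right)
  have key : M.w v a ≠ 0 → M.w v b ≠ 0 → s < M.w a b + 1 → M.HasK23 := by
    intro hva hvb hlt
    rcases s with _ | s
    · exact ⟨_, _, _, 0, hmod, Or.inl rfl⟩
    · exact ⟨_, _, _, s, hmod.add_connector (v := v) (by simp) (by simp) (by simp)
        ⟨a, ⟨ha, hav⟩, Adj.symm (G := M.graph) hva⟩ ⟨b, ⟨hb, hbv⟩, Adj.symm (G := M.graph) hvb⟩,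
        Or.inr ⟨a, ⟨ha, hav⟩, b, ⟨hb, hbv⟩, by omega⟩⟩
  by_cases h : a = u ∧ b = t
  · obtain ⟨rfl, rfl⟩ := h
    rw [reduce_w_pair huv htv (ne_of_w hw)] at hab
    exact key hu ht hab
  by_cases h' : a = t ∧ b = u
  · obtain ⟨rfl, rfl⟩ := h'
    rw [WGraph.symm, reduce_w_pair huv htv (ne_of_w hw), M.symm] at hab
    exact key ht hu hab
  · rw [reduce_w hav hbv h h'] at hab
    exact ⟨_, _, _, s, hmod, Or.inr ⟨a, ⟨ha, hav⟩, b, ⟨hb, hbv⟩, hab⟩⟩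

/-- An edge of weight at least 3 supplies two connections between `{v}` and `{u}`; the vertices
reached from `t` without `v` and `u` supply the third. -/
theorem hasK23_of_three_le (h3 : 3 ≤ M.w v u) (ht : M.w v t ≠ 0) (htu : t ≠ u)
    (hr : (M.graph.within {v}ᶜ).Reachable t u) : M.HasK23 := by
  obtain ⟨q, hq, htq⟩ := hr.exists_adj_last htu
  have hD : ∀ x, ((M.graph.within {v}ᶜ).within {u}ᶜ).Reachable t x → x ≠ v ∧ x ≠ u :=
    fun x hx => ⟨(hx.mono within_le).mem_of_within (ne_of_w ht).symm, hx.mem_of_within htu⟩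
  have huv : v ≠ u := ne_of_w (M := M) (by omega)
  have hi : ∀ i, 2 ≤ i → i < 3 → i = 2 := fun i _ _ => by omega
  refine ⟨{v}, {u}, fun _ => {x | ((M.graph.within {v}ᶜ).within {u}ᶜ).Reachable t x}, 2,
    ⟨connOn_singleton v, connOn_singleton u, by simpa using huv, fun _ _ _ =>
      connOn_setOf_reachable (within_le.trans within_le) t, fun _ _ _ => ?_, fun _ _ _ => ?_,
      fun _ _ _ => ⟨v, rfl, t, Reachable.refl _, ht⟩, fun _ _ _ => ⟨u, rfl, q, htq, hq.1⟩,
      fun i j h1 h2 h3 h4 h5 => (h5 ((hi i h1 h2).trans (hi j h3 h4).symm)).elim⟩,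
    Or.inr ⟨v, rfl, u, rfl, h3⟩⟩
  · exact Set.disjoint_singleton_left.2 fun h => (hD _ h).1 rfl
  · exact Set.disjoint_singleton_left.2 fun h => (hD _ h).2 rfl

end WGraph

/-! ### Adding and deleting edges of forests -/

namespace SimpleGraph

variable {V : Type*} {F G : SimpleGraph V} {a b u t v x y z : V}

theorem reachable_sup_edge_iff : (F ⊔ edge a b).Reachable x y ↔
    F.Reachable x y ∨ (F.Reachable x a ∧ F.Reachable b y) ∨
      (F.Reachable x b ∧ F.Reachable a y) := by
  constructor
  · intro h
    refine h.induction_on (P := fun y => F.Reachable x y ∨ (F.Reachable x a ∧ F.Reachable b y) ∨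
      (F.Reachable x b ∧ F.Reachable a y)) (Or.inl (Reachable.refl _)) ?_
    rintro p q - hp hpq
    rcases hpq with hpq | hpq
    · have := hpq.reachable
      exact hp.imp (·.trans this) (Or.imp (.imp_right (·.trans this)) (.imp_right (·.trans this)))
    · rw [edge_adj] at hpq
      obtain ⟨⟨rfl, rfl⟩ | ⟨rfl, rfl⟩, -⟩ := hpq
      · rcases hp with h | h | h
        · exact Or.inr (Or.inl ⟨h, Reachable.refl _⟩)
        · exact Or.inr (Or.inl ⟨h.1, Reachable.refl _⟩)
        · exact Or.inl h.1
      · rcases hp with h | h | h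
        · exact Or.inr (Or.inr ⟨h, Reachable.refl _⟩)
        · exact Or.inl h.1
        · exact Or.inr (Or.inr ⟨h.1, Reachable.refl _⟩)
  · have hab : (F ⊔ edge a b).Reachable a b := by
      by_cases h : a = b
      · subst h
        exact Reachable.refl _
      · exact Adj.reachable (Or.inr ((edge_adj ..).2 ⟨Or.inl ⟨rfl, rfl⟩, h⟩))
    rintro (h | ⟨h, h'⟩ | ⟨h, h'⟩)
    · exact h.mono le_sup_left
    · exact ((h.mono le_sup_left).trans hab).trans (h'.mono le_sup_left)
    · exact ((h.mono le_sup_left).trans hab.symm).trans (h'.mono le_sup_left)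

theorem sup_edge_adj_iff (hab : a ≠ b) :
    (F ⊔ edge a b).Adj x y ↔ F.Adj x y ∨ (x = a ∧ y = b) ∨ (x = b ∧ y = a) := by
  rw [sup_adj, edge_adj]
  refine or_congr_right ⟨fun h => h.1, fun h => ⟨h, ?_⟩⟩
  rcases h with ⟨rfl, rfl⟩ | ⟨rfl, rfl⟩
  exacts [hab, hab.symm]

theorem Reachable.eq_of_isolated (h : F.Reachable v x) (hv : ∀ x, ¬ F.Adj v x) : x = v :=
  h.induction_on (P := fun z => z = v) rfl fun _ _ _ hp hpq => absurd (hp ▸ hpq) (hv _)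

theorem IsAcyclic.not_reachable_deleteEdges (hF : F.IsAcyclic) (hab : F.Adj a b) :
    ¬ (F.deleteEdges {s(a, b)}).Reachable a b :=
  isBridge_iff.1 (isAcyclic_iff_forall_adj_isBridge.1 hF hab)

theorem deleteEdges_sup_edge (hab : F.Adj a b) : F.deleteEdges {s(a, b)} ⊔ edge a b = F := by
  ext x y
  rw [sup_edge_adj_iff hab.ne, deleteEdges_adj]
  simp only [Set.mem_singleton_iff, Sym2.eq_iff]
  constructor
  · rintro (h | ⟨rfl, rfl⟩ | ⟨rfl, rfl⟩)
    exacts [h.1, hab, hab.symm]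
  · tauto

theorem within_compl_sup_edge (hvu : F.Adj v u) (h : ∀ x, F.Adj v x → x = u) :
    F.within {v}ᶜ ⊔ edge v u = F := by
  ext x y
  rw [sup_edge_adj_iff hvu.ne]
  constructor
  · rintro (h | ⟨rfl, rfl⟩ | ⟨rfl, rfl⟩)
    exacts [h.1, hvu, hvu.symm]
  · intro hxy
    by_cases hx : x = v
    · subst hx
      exact Or.inr (Or.inl ⟨rfl, h y hxy⟩)
    by_cases hy : y = v
    · subst hy
      exact Or.inr (Or.inr ⟨h x hxy.symm, rfl⟩)
    · exact Or.inl ⟨hxy, hx, hy⟩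

theorem within_compl_sup_edge_edge (hvu : F.Adj v u) (hvt : F.Adj v t)
    (h : ∀ x, F.Adj v x → x = u ∨ x = t) :
    F.within {v}ᶜ ⊔ edge v u ⊔ edge v t = F := by
  ext x y
  rw [sup_edge_adj_iff hvt.ne, sup_edge_adj_iff hvu.ne]
  constructor
  · rintro ((h | ⟨rfl, rfl⟩ | ⟨rfl, rfl⟩) | ⟨rfl, rfl⟩ | ⟨rfl, rfl⟩)
    exacts [h.1, hvu, hvu.symm, hvt, hvt.symm]
  · intro hxy
    by_cases hx : x = v
    · subst hx
      rcases h y hxy with rfl | rfl <;> simp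
    by_cases hy : y = v
    · subst hy
      rcases h x hxy.symm with rfl | rfl <;> simp
    · exact Or.inl (Or.inl ⟨hxy, hx, hy⟩)

theorem IsAcyclic.not_reachable_within_compl (hF : F.IsAcyclic) (hvu : F.Adj v u)
    (hvt : F.Adj v t) (hut : u ≠ t) : ¬ (F.within {v}ᶜ).Reachable u t := by
  intro h
  refine hF.not_reachable_deleteEdges hvt (Reachable.trans (v := u) (Adj.reachable ?_)
    (h.mono ?_))
  · rw [deleteEdges_adj]
    refine ⟨hvu, ?_⟩
    simp only [Set.mem_singleton_iff, Sym2.eq_iff]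
    rintro (h | h)
    · exact hut h.2
    · exact hvt.ne h.1
  · intro p q hpq
    rw [deleteEdges_adj]
    refine ⟨hpq.1, ?_⟩
    simp only [Set.mem_singleton_iff, Sym2.eq_iff]
    rintro (h | h)
    · exact hpq.2.1 h.1
    · exact hpq.2.2 h.2

/-- The last edge of the path from `u` to `t` will do: the rest of the path avoids `t`, so a second
connection would close a cycle. -/
theorem IsAcyclic.exists_separating_edge (hF : F.IsAcyclic) (hut : u ≠ t)
    (h : F.Reachable u t) : ∃ q, F.Adj t q ∧ ¬ (F.deleteEdges {s(t, q)}).Reachable u t := by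
  obtain ⟨q, hq, huq⟩ := h.exists_adj_last hut
  refine ⟨q, hq, fun h => hF.not_reachable_deleteEdges hq (h.symm.trans (huq.mono ?_))⟩
  intro x y hxy
  rw [deleteEdges_adj]
  refine ⟨hxy.1, ?_⟩
  simp only [Set.mem_singleton_iff, Sym2.eq_iff]
  rintro (h | h)
  · exact hxy.2.1 h.1
  · exact hxy.2.2 h.2

end SimpleGraph

/-! ### Valid and optimal forests -/

namespace WGraph

open SimpleGraph

variable {V : Type*} {M M' : WGraph V} {F F' : SimpleGraph V} {S : Set V} {a b u t v x y z : V}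

/-- The edges of weight one. -/
def light (M : WGraph V) : SimpleGraph V where
  Adj x y := M.w x y = 1
  symm := ⟨fun x y h => by rwa [M.symm y x]⟩
  loopless := ⟨fun x h => by simp [M.irrefl] at h⟩

/-- A forest whose trees are induced in the weighted graph and which uses no edge of weight more
than two. -/
structure Valid (M : WGraph V) (F : SimpleGraph V) : Prop where
  acyclic : F.IsAcyclic
  ne_zero : ∀ x y, F.Adj x y → M.w x y ≠ 0
  le_two : ∀ x y, F.Adj x y → M.w x y ≤ 2
  closed : ∀ x y, M.w x y ≠ 0 → F.Reachable x y → F.Adj x y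

/-- The number of edges of weight one of a forest. -/
noncomputable def val (M : WGraph V) (F : SimpleGraph V) : ℕ :=
  (F.edgeSet ∩ M.light.edgeSet).ncard

theorem val_congr (h : ∀ x y, F.Adj x y → M.w x y = M'.w x y) : M.val F = M'.val F := by
  unfold val
  congr 1
  ext e
  induction e with
  | _ x y =>
    refine and_congr_right fun hxy => ?_
    change M.w x y = 1 ↔ M'.w x y = 1
    rw [h x y hxy]

theorem val_sup_edge [Finite V] (hab : a ≠ b) (h : ¬ F.Adj a b) :
    M.val (F ⊔ edge a b) = M.val F + if M.w a b = 1 then 1 else 0 := by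
  unfold val
  rw [edgeSet_sup, edgeSet_edge_of_ne hab, Set.union_inter_distrib_right]
  split_ifs with h1
  · have : ({s(a, b)} : Set (Sym2 V)) ∩ M.light.edgeSet = {s(a, b)} :=
      Set.inter_eq_left.2 (Set.singleton_subset_iff.2 h1)
    rw [this, Set.union_singleton, Set.ncard_insert_of_notMem (fun hm => h hm.1) (Set.toFinite _)]
  · have : ({s(a, b)} : Set (Sym2 V)) ∩ M.light.edgeSet = ∅ :=
      Set.singleton_inter_eq_empty.2 h1
    rw [this, Set.union_empty, add_zero]

theorem val_le_of_deleteEdges [Finite V] (h : F.Adj a b) :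
    M.val F ≤ M.val (F.deleteEdges {s(a, b)}) + 1 := by
  conv_lhs => rw [← deleteEdges_sup_edge h]
  rw [val_sup_edge h.ne (by simp)]
  split_ifs <;> omega

theorem not_adj_of_isolated (hF : M.Valid F) (hv : ∀ x, M.w v x = 0) : ∀ x, ¬ F.Adj v x :=
  fun x h => hF.ne_zero v x h (hv x)

theorem valid_bot : M.Valid ⊥ :=
  ⟨isAcyclic_bot, fun _ _ h => h.elim, fun _ _ h => h.elim, fun x y h hr => by
    rw [hr.symm.eq_of_isolated (fun _ h => h.elim)] at h
    exact (h (M.irrefl _)).elim⟩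

/-- Hang the isolated vertex `v` on the vertex `y`. -/
theorem Valid.attach (hF : M'.Valid F) (hv0 : ∀ x, M'.w v x = 0) (hy : M.w v y ≠ 0)
    (hy2 : M.w v y ≤ 2) (hv : ∀ x, M.w v x ≠ 0 → x = y ∨ ¬ F.Reachable y x)
    (hagree : ∀ a b, a ≠ v → b ≠ v → F.Reachable a b → M.w a b = M'.w a b) :
    M.Valid (F ⊔ edge v y) := by
  have hiso := not_adj_of_isolated hF hv0
  have hvy := ne_of_w hy
  have hnr : ∀ x, x ≠ v → ¬ F.Reachable v x := fun x hx h => hx (h.eq_of_isolated hiso)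
  have hne : ∀ a b, F.Adj a b → a ≠ v ∧ b ≠ v := fun a b h =>
    ⟨fun ha => hiso b (ha ▸ h), fun hb => hiso a (hb ▸ h.symm)⟩
  have hclosed : ∀ b, M.w v b ≠ 0 → (F ⊔ edge v y).Reachable v b → b = y := by
    intro b hb h
    rcases reachable_sup_edge_iff.1 h with h | h | h
    · exact (hnr b (ne_of_w hb).symm h).elim
    · exact (hv b hb).resolve_right fun h' => h' h.2
    · exact (hnr y hvy.symm h.1).elim
  refine ⟨hF.acyclic.sup_edge_of_not_reachable (hnr y hvy.symm), fun a b h => ?_,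
    fun a b h => ?_, fun a b hab h => (sup_edge_adj_iff hvy).2 ?_⟩
  · rcases (sup_edge_adj_iff hvy).1 h with h | ⟨rfl, rfl⟩ | ⟨rfl, rfl⟩
    · rw [hagree a b (hne a b h).1 (hne a b h).2 h.reachable]
      exact hF.ne_zero a b h
    · exact hy
    · rwa [M.symm]
  · rcases (sup_edge_adj_iff hvy).1 h with h | ⟨rfl, rfl⟩ | ⟨rfl, rfl⟩
    · rw [hagree a b (hne a b h).1 (hne a b h).2 h.reachable]
      exact hF.le_two a b h
    · exact hy2
    · rwa [M.symm]
  · by_cases ha : a = v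
    · subst ha
      exact Or.inr (Or.inl ⟨rfl, hclosed b hab h⟩)
    by_cases hb : b = v
    · subst hb
      exact Or.inr (Or.inr ⟨hclosed a (M.symm a b ▸ hab) h.symm, rfl⟩)
    rcases reachable_sup_edge_iff.1 h with h | h | h
    · rw [hagree a b ha hb h] at hab
      exact Or.inl (hF.closed a b hab h)
    · exact (hnr a ha h.1.symm).elim
    · exact (hnr b hb h.2).elim

theorem val_attach [Finite V] (hF : M'.Valid F) (hv0 : ∀ x, M'.w v x = 0) (hvy : v ≠ y)
    (hagree : ∀ a b, a ≠ v → b ≠ v → F.Reachable a b → M.w a b = M'.w a b) :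
    M.val (F ⊔ edge v y) = M'.val F + if M.w v y = 1 then 1 else 0 := by
  have hiso := not_adj_of_isolated hF hv0
  rw [val_sup_edge hvy (hiso y)]
  congr 1
  exact val_congr fun a b h => hagree a b (fun ha => hiso b (ha ▸ h))
    (fun hb => hiso a (hb ▸ h.symm)) h.reachable

/-- Join two trees by an edge, when no other edge joins them. -/
theorem Valid.join (hF : M.Valid F) (hut : M.w u t ≠ 0) (hut2 : M.w u t ≤ 2)
    (hnr : ¬ F.Reachable u t)
    (h : ∀ a b, F.Reachable a u → F.Reachable b t → M.w a b ≠ 0 → a = u ∧ b = t) :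
    M.Valid (F ⊔ edge u t) := by
  have hne := ne_of_w hut
  refine ⟨hF.acyclic.sup_edge_of_not_reachable hnr, fun a b hab => ?_, fun a b hab => ?_,
    fun a b hab hr => (sup_edge_adj_iff hne).2 ?_⟩
  · rcases (sup_edge_adj_iff hne).1 hab with hab | ⟨rfl, rfl⟩ | ⟨rfl, rfl⟩
    exacts [hF.ne_zero a b hab, hut, by rwa [M.symm]]
  · rcases (sup_edge_adj_iff hne).1 hab with hab | ⟨rfl, rfl⟩ | ⟨rfl, rfl⟩
    exacts [hF.le_two a b hab, hut2, by rwa [M.symm]]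
  · rcases reachable_sup_edge_iff.1 hr with hr | hr | hr
    · exact Or.inl (hF.closed a b hab hr)
    · exact Or.inr (Or.inl (h a b hr.1 hr.2.symm hab))
    · have := h b a hr.2.symm hr.1 (M.symm a b ▸ hab)
      exact Or.inr (Or.inr ⟨this.2, this.1⟩)

theorem Valid.deleteEdges (hF : M.Valid F) (hab : F.Adj a b) :
    M.Valid (F.deleteEdges {s(a, b)}) := by
  have hle : F.deleteEdges {s(a, b)} ≤ F := deleteEdges_le _
  refine ⟨hF.acyclic.anti hle, fun x y h => hF.ne_zero x y (hle h),
    fun x y h => hF.le_two x y (hle h), fun x y hxy hr => ?_⟩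
  rw [deleteEdges_adj]
  refine ⟨hF.closed x y hxy (hr.mono hle), ?_⟩
  simp only [Set.mem_singleton_iff, Sym2.eq_iff]
  have := hF.acyclic.not_reachable_deleteEdges hab
  rintro (⟨rfl, rfl⟩ | ⟨rfl, rfl⟩)
  · exact this hr
  · exact this hr.symm

theorem Valid.within_compl (hF : M.Valid F) (hv0 : ∀ x, M'.w v x = 0)
    (hagree : ∀ a b, a ≠ v → b ≠ v → (F.within {v}ᶜ).Reachable a b → M.w a b = M'.w a b) :
    M'.Valid (F.within {v}ᶜ) := by
  refine ⟨hF.acyclic.anti within_le, fun x y h => ?_, fun x y h => ?_, fun x y hxy hr => ?_⟩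
  · rw [← hagree x y h.2.1 h.2.2 h.reachable]
    exact hF.ne_zero x y h.1
  · rw [← hagree x y h.2.1 h.2.2 h.reachable]
    exact hF.le_two x y h.1
  · have hx : x ≠ v := fun h => hxy (h ▸ hv0 y)
    have hy : y ≠ v := fun h => hxy (by rw [h, M'.symm]; exact hv0 x)
    rw [← hagree x y hx hy hr] at hxy
    exact ⟨hF.closed x y hxy (hr.mono within_le), hx, hy⟩

theorem val_within_compl
    (hagree : ∀ a b, a ≠ v → b ≠ v → (F.within {v}ᶜ).Reachable a b → M.w a b = M'.w a b) :
    M.val (F.within {v}ᶜ) = M'.val (F.within {v}ᶜ) :=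
  val_congr fun a b h => hagree a b h.2.1 h.2.2 h.reachable

/-- A forest with the greatest possible number of edges of weight one. -/
def Optimal (M : WGraph V) (F : SimpleGraph V) : Prop :=
  M.Valid F ∧ ∀ F', M.Valid F' → M.val F' ≤ M.val F

theorem exists_optimal [Finite V] (M : WGraph V) : ∃ F, M.Optimal F := by
  have : Finite (SimpleGraph V) :=
    Finite.of_injective (fun G : SimpleGraph V => G.Adj) fun _ _ h => SimpleGraph.ext h
  obtain ⟨F, hF, hmax⟩ := Set.exists_max_image {F | M.Valid F} M.val (Set.toFinite _)
    ⟨⊥, valid_bot⟩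
  exact ⟨F, hF, hmax⟩

end WGraph

/-! ### Pendant trees of a forest -/

namespace SimpleGraph

variable {V : Type*} {F F' G G' : SimpleGraph V} {a b r u t v x y z : V}

theorem within_compl_of_isolated (h : ∀ x, ¬ F.Adj v x) : F.within {v}ᶜ = F := by
  ext x y
  refine ⟨fun h => h.1, fun hxy => ⟨hxy, ?_, ?_⟩⟩
  · rintro rfl
    exact h y hxy
  · rintro rfl
    exact h x hxy.symm

theorem ne_of_isolated (hv : ∀ x, ¬ F.Adj v x) (h : F.Adj a b) : a ≠ v ∧ b ≠ v :=
  ⟨fun ha => hv b (ha ▸ h), fun hb => hv a (hb ▸ h.symm)⟩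

theorem not_within_compl_adj : ¬ (F.within {v}ᶜ).Adj v x := fun h => h.2.1 rfl

theorem reachable_attach_iff (hv : ∀ x, ¬ F.Adj v x) (hvy : v ≠ y) :
    (F ⊔ edge v y).Reachable a b ↔ F.Reachable (merge v y a) (merge v y b) := by
  have hnr : ∀ x, x ≠ v → ¬ F.Reachable v x := fun x hx h => hx (h.eq_of_isolated hv)
  have hnr' : ∀ x, x ≠ v → ¬ F.Reachable x v := fun x hx h => hnr x hx h.symm
  rw [reachable_sup_edge_iff]
  by_cases ha : a = v <;> by_cases hb : b = v
  · subst ha; subst hb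
    simp [merge_self]
  · subst ha
    simp [merge_self, merge_of_ne hb, hnr b hb, hnr y hvy.symm]
  · subst hb
    simp [merge_self, merge_of_ne ha, hnr' a ha, hnr' y hvy.symm]
  · simp [merge_of_ne ha, merge_of_ne hb, hnr' a ha, hnr b hb]

/-- Some tree of the forest `F` that does not contain `r` is joined by edges of `G` to exactly one
other tree. -/
def HasPendant (G F : SimpleGraph V) (r : V) : Prop :=
  ∃ x, ¬ F.Reachable x r ∧ (∃ p q, F.Reachable x p ∧ G.Adj p q ∧ ¬ F.Reachable x q) ∧
    ∀ p q p' q', F.Reachable x p → G.Adj p q → ¬ F.Reachable x q →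
      F.Reachable x p' → G.Adj p' q' → ¬ F.Reachable x q' → F.Reachable q q'

/-- The map `ρ` identifies the trees of `F` with trees of `F'`. Edges of `G` go to edges of `G'` or
into a single tree, and every edge of `G'` arises from one of `G` up to moving within trees.
Adjacency of trees is thus preserved where it matters. -/
theorem HasPendant.transport (h : G'.HasPendant F' r) (ρ : V → V)
    (hR : ∀ x y, F.Reachable x y ↔ F'.Reachable (ρ x) (ρ y))
    (hρ : ∀ x y, G.Adj x y → F'.Reachable (ρ x) (ρ y) ∨ G'.Adj (ρ x) (ρ y))
    (hex : ∀ x y, G'.Adj x y → ∃ x' y', G.Adj x' y' ∧ F'.Reachable x (ρ x') ∧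
      F'.Reachable y (ρ y')) (hr : ρ r = r) : G.HasPendant F r := by
  obtain ⟨x, hxr, ⟨p, q, hxp, hpq, hxq⟩, huniq⟩ := h
  obtain ⟨x', y', hadj, hpx, hqy⟩ := hex p q hpq
  have hxx := hxp.trans hpx
  have hiff : ∀ z, F.Reachable x' z ↔ F'.Reachable x (ρ z) := fun z => by
    rw [hR]
    exact ⟨hxx.trans, hxx.symm.trans⟩
  refine ⟨x', fun h => hxr (hr ▸ (hiff r).1 h), ⟨x', y', Reachable.refl _, hadj, fun h =>
    hxq (((hiff y').1 h).trans hqy.symm)⟩, fun p q p' q' h1 h2 h3 h4 h5 h6 => ?_⟩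
  rw [hiff] at h1 h3 h4 h6
  rw [hR]
  exact huniq _ _ _ _ h1 ((hρ p q h2).resolve_left fun h => h3 (h1.trans h)) h3 h4
    ((hρ p' q' h5).resolve_left fun h => h6 (h4.trans h)) h6

theorem hasPendant_of_isolated (hv : ∀ x, ¬ F.Adj v x) (hvr : v ≠ r) (hvu : G.Adj v u)
    (h : ∀ q q', G.Adj v q → G.Adj v q' → F.Reachable q q') : G.HasPendant F r := by
  have hiso : ∀ x, F.Reachable v x → x = v := fun x hx => hx.eq_of_isolated hv
  refine ⟨v, fun h => hvr (hiso r h).symm, ⟨v, u, Reachable.refl _, hvu, fun h =>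
    hvu.ne (hiso u h).symm⟩, fun p q p' q' h1 h2 _ h4 h5 _ => ?_⟩
  rw [hiso p h1] at h2
  rw [hiso p' h4] at h5
  exact h q q' h2 h5

end SimpleGraph

/-! ### Lifting good forests through reductions -/

namespace WGraph

open SimpleGraph

variable {V : Type*} {M M' : WGraph V} {F F' : SimpleGraph V} {S : Set V} {a b r u t v x y z : V}
  {k : ℕ}

/-- Some optimal forest contains an edge of weight two or has a pendant tree avoiding `r`. -/
def Good (M : WGraph V) (r : V) : Prop :=
  ∃ F, M.Optimal F ∧ ((∃ x y, F.Adj x y ∧ 2 ≤ M.w x y) ∨ M.graph.HasPendant F r)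

theorem within_compl_w_left : (M.within {v}ᶜ).w v x = 0 := if_neg (by simp)

theorem within_compl_w (hx : x ≠ v) (hy : y ≠ v) : (M.within {v}ᶜ).w x y = M.w x y :=
  within_w_of_mem hx hy

theorem Valid.of_within_compl (hF : (M.within {v}ᶜ).Valid F) : M.Valid F := by
  have hiso : ∀ x, ¬ F.Adj v x := not_adj_of_isolated hF fun _ => within_compl_w_left
  have hne : ∀ a b, F.Adj a b → M.w a b = (M.within {v}ᶜ).w a b := fun a b h =>
    (within_compl_w (ne_of_isolated hiso h).1 (ne_of_isolated hiso h).2).symm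
  refine ⟨hF.acyclic, fun x y h => hne x y h ▸ hF.ne_zero x y h,
    fun x y h => hne x y h ▸ hF.le_two x y h, fun x y hxy hr => hF.closed x y ?_ hr⟩
  have hx : x ≠ v := by
    rintro rfl
    exact ne_of_w hxy (hr.eq_of_isolated hiso).symm
  have hy : y ≠ v := by
    rintro rfl
    exact ne_of_w hxy (hr.symm.eq_of_isolated hiso)
  rwa [within_compl_w hx hy]

theorem val_eq_within_compl (h : ∀ x, M.w v x ≠ 1) : M.val F = M.val (F.within {v}ᶜ) := by
  unfold val
  congr 1
  ext e
  induction e with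
  | _ x y =>
    refine ⟨fun hxy => ⟨⟨hxy.1, ?_, ?_⟩, hxy.2⟩, fun hxy => ⟨hxy.1.1, hxy.2⟩⟩
    · rintro rfl
      exact h y hxy.2
    · rintro rfl
      exact h x ((M.symm _ _).trans hxy.2)

theorem val_of_within_compl (hF : (M.within {v}ᶜ).Valid F) :
    M.val F = (M.within {v}ᶜ).val F := by
  have hiso : ∀ x, ¬ F.Adj v x := not_adj_of_isolated hF fun _ => within_compl_w_left
  exact val_congr fun a b h =>
    (within_compl_w (ne_of_isolated hiso h).1 (ne_of_isolated hiso h).2).symm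

theorem Valid.within_compl_self (hF : M.Valid F) : (M.within {v}ᶜ).Valid (F.within {v}ᶜ) :=
  hF.within_compl (fun _ => within_compl_w_left) fun _ _ ha hb _ => (within_compl_w ha hb).symm

theorem val_within_compl_self : M.val (F.within {v}ᶜ) = (M.within {v}ᶜ).val (F.within {v}ᶜ) :=
  val_within_compl fun _ _ ha hb _ => (within_compl_w ha hb).symm

/-- Without light edges at `v`, no forest gains value from `v`, so `v` may be left isolated. -/
theorem Optimal.of_within_compl (hF : (M.within {v}ᶜ).Optimal F) (h : ∀ x, M.w v x ≠ 1) :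
    M.Optimal F := by
  refine ⟨hF.1.of_within_compl, fun F' hF' => ?_⟩
  rw [val_eq_within_compl h, val_within_compl_self, val_of_within_compl hF.1]
  exact hF.2 _ hF'.within_compl_self

theorem reduce_agree (h : ¬ F.Reachable u t) (ha : a ≠ v) (hb : b ≠ v) (hab : F.Reachable a b) :
    M.w a b = (M.reduce v u t k).w a b := by
  refine (reduce_w ha hb ?_ ?_).symm
  · rintro ⟨rfl, rfl⟩
    exact h hab
  · rintro ⟨rfl, rfl⟩
    exact h hab.symm

variable [Finite V]

/-- A vertex of degree one hanging on an edge of weight more than one. -/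
theorem good_of_heavy_leaf (hvr : v ≠ r) (hu : 2 ≤ M.w v u) (hN : ∀ x, M.w v x ≠ 0 → x = u) :
    M.Good r := by
  obtain ⟨F, hF⟩ := (M.within {v}ᶜ).exists_optimal
  refine ⟨F, hF.of_within_compl fun x hx => ?_, Or.inr (hasPendant_of_isolated
    (not_adj_of_isolated hF.1 fun _ => within_compl_w_left) hvr
    (show M.w v u ≠ 0 by omega) fun q q' hq hq' => ?_)⟩
  · rw [hN x (by omega)] at hx
    omega
  · rw [hN q hq, hN q' hq']

/-- The leaf `v` can always be hung on `u` for one unit of value, and it merges into the tree of `u`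
without changing which trees are adjacent. -/
theorem Good.of_light_leaf (hvr : v ≠ r) (hu : M.w v u = 1) (hN : ∀ x, M.w v x ≠ 0 → x = u)
    (h : (M.within {v}ᶜ).Good r) : M.Good r := by
  obtain ⟨F, hF, hgoal⟩ := h
  have hvu : v ≠ u := ne_of_w (M := M) (by omega)
  have hiso := not_adj_of_isolated hF.1 fun _ => within_compl_w_left
  have hagree : ∀ a b, a ≠ v → b ≠ v → F.Reachable a b → M.w a b = (M.within {v}ᶜ).w a b :=
    fun a b ha hb _ => (within_compl_w ha hb).symm
  refine ⟨F ⊔ edge v u, ⟨hF.1.attach (fun _ => within_compl_w_left) (by omega) (by omega)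
    (fun x hx => Or.inl (hN x hx)) hagree, fun F' hF' => ?_⟩, ?_⟩
  · rw [val_attach hF.1 (fun _ => within_compl_w_left) hvu hagree, if_pos hu]
    refine le_trans ?_ (Nat.add_le_add_right (hF.2 _ hF'.within_compl_self) 1)
    rw [← val_within_compl_self]
    by_cases hadj : F'.Adj v u
    · conv_lhs => rw [← within_compl_sup_edge hadj fun x hx => hN x (hF'.ne_zero v x hx)]
      rw [val_sup_edge hvu not_within_compl_adj]
      split_ifs
      omega
    · rw [within_compl_of_isolated fun x hx => hadj (hN x (hF'.ne_zero v x hx) ▸ hx)]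
      omega
  · rcases hgoal with ⟨x, y, hxy, h2⟩ | hp
    · exact Or.inl ⟨x, y, Or.inl hxy, h2.trans (within_w_le x y)⟩
    · refine Or.inr (hp.transport (merge v u) (fun a b => reachable_attach_iff hiso hvu)
        (fun x y hxy => ?_) (fun x y hxy => ?_) (merge_of_ne hvr.symm))
      · by_cases hx : x = v
        · subst hx
          rw [hN y hxy, merge_self, merge_of_ne hvu.symm]
          exact Or.inl (Reachable.refl _)
        by_cases hy : y = v
        · subst hy
          rw [hN x hxy.symm, merge_self, merge_of_ne hvu.symm]
          exact Or.inl (Reachable.refl _)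
        · rw [merge_of_ne hx, merge_of_ne hy]
          refine Or.inr ?_
          change (M.within {v}ᶜ).w x y ≠ 0
          rwa [within_compl_w hx hy]
      · obtain ⟨hx, hy⟩ := mem_of_within_w hxy
        refine ⟨x, y, ?_, ?_, ?_⟩
        · change (M.within {v}ᶜ).w x y ≠ 0 at hxy
          rwa [within_compl_w hx hy] at hxy
        · rw [merge_of_ne hx]
        · rw [merge_of_ne hy]

/-- The upper bound for the reduction: `v` is worth at most one unit. If both edges at `v` are used,
then `u` and `t` are not adjacent, and the path through `v` becomes the edge `ut` of weight `M.w v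
u`, which loses just the light edge. -/
theorem exists_valid_reduce (hu : M.w v u ≠ 0) (ht : M.w v t = 1)
    (hN : ∀ x, M.w v x ≠ 0 → x = u ∨ x = t) (hut : u ≠ t) (hk : M.w u t = 0 → k = M.w v u)
    (hF : M.Valid F) :
    ∃ F', (M.reduce v u t k).Valid F' ∧ M.val F ≤ (M.reduce v u t k).val F' + 1 := by
  have huv := (ne_of_w hu).symm
  have htv : t ≠ v := (ne_of_w (M := M) (by omega)).symm
  have hmain : ∀ F₀ : SimpleGraph V, M.Valid F₀ → ¬ (F₀.within {v}ᶜ).Reachable u t →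
      (M.reduce v u t k).Valid (F₀.within {v}ᶜ) ∧
      M.val (F₀.within {v}ᶜ) = (M.reduce v u t k).val (F₀.within {v}ᶜ) := fun F₀ hF₀ hnr =>
    ⟨hF₀.within_compl (fun _ => reduce_w_left) fun _ _ => reduce_agree hnr,
      val_within_compl fun _ _ => reduce_agree hnr⟩
  by_cases h1 : F.Adj v u <;> by_cases h2 : F.Adj v t
  · have hnr := hF.acyclic.not_reachable_within_compl h1 h2 hut
    have hr : F.Reachable u t := h1.symm.reachable.trans h2.reachable
    have h0 : M.w u t = 0 := by
      by_contra h0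
      exact hnr (Adj.reachable ⟨hF.closed u t h0 hr, huv, htv⟩)
    have hw : (M.reduce v u t k).w u t = M.w v u := by rw [reduce_w_pair huv htv hut, hk h0]
    obtain ⟨hval, heq⟩ := hmain F hF hnr
    refine ⟨F.within {v}ᶜ ⊔ edge u t, hval.join (by rwa [hw]) (hw ▸ hF.le_two v u h1) hnr
      fun a b ha hb hab => ?_, ?_⟩
    · by_contra hne
      have hav : a ≠ v := fun h => hab (h ▸ reduce_w_left)
      have hbv : b ≠ v := fun h => hab (h ▸ reduce_w_right)
      have hne' : ¬ (a = t ∧ b = u) := by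
        rintro ⟨rfl, rfl⟩
        exact hnr hb
      rw [reduce_w hav hbv hne hne'] at hab
      exact hnr ((ha.symm.trans (Adj.reachable ⟨hF.closed a b hab
        (((ha.mono within_le).trans hr).trans (hb.mono within_le).symm), hav, hbv⟩)).trans hb)
    · conv_lhs => rw [← within_compl_sup_edge_edge h1 h2 fun x hx => hN x (hF.ne_zero v x hx)]
      rw [val_sup_edge htv.symm, val_sup_edge huv.symm not_within_compl_adj,
        val_sup_edge hut (fun h => hnr h.reachable), hw, heq, if_pos ht]
      rw [sup_edge_adj_iff huv.symm]
      rintro (h | ⟨-, h⟩ | ⟨h, -⟩)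
      exacts [h.2.1 rfl, hut h.symm, huv h.symm]
  · have hnr : ¬ (F.within {v}ᶜ).Reachable u t := fun h =>
      h2 (hF.closed v t (by omega) (h1.reachable.trans (h.mono within_le)))
    obtain ⟨hval, heq⟩ := hmain F hF hnr
    refine ⟨_, hval, ?_⟩
    conv_lhs => rw [← within_compl_sup_edge h1 fun x hx =>
      (hN x (hF.ne_zero v x hx)).resolve_right fun h => h2 (h ▸ hx)]
    rw [val_sup_edge huv.symm not_within_compl_adj, heq]
    split_ifs <;> omega
  · have hnr : ¬ (F.within {v}ᶜ).Reachable u t := fun h =>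
      h1 (hF.closed v u hu (h2.reachable.trans (h.mono within_le).symm))
    obtain ⟨hval, heq⟩ := hmain F hF hnr
    refine ⟨_, hval, ?_⟩
    conv_lhs => rw [← within_compl_sup_edge h2 fun x hx =>
      (hN x (hF.ne_zero v x hx)).resolve_left fun h => h1 (h ▸ hx)]
    rw [val_sup_edge htv.symm not_within_compl_adj, heq]
    split_ifs
    omega
  · have hiso : ∀ x, ¬ F.Adj v x := fun x hx => by
      rcases hN x (hF.ne_zero v x hx) with rfl | rfl
      exacts [h1 hx, h2 hx]
    -- Here `v` contributes nothing, so the unit of slack pays for deleting an edge that separates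
    -- `u` from `t`. Then the new weight of `ut` is irrelevant to the forest.
    obtain ⟨F₁, hF₁, hle, hnr, hv⟩ : ∃ F₁, M.Valid F₁ ∧ F₁ ≤ F ∧ ¬ F₁.Reachable u t ∧
        M.val F ≤ M.val F₁ + 1 := by
      by_cases hr : F.Reachable u t
      · obtain ⟨q, hq, hsep⟩ := hF.acyclic.exists_separating_edge hut hr
        exact ⟨_, hF.deleteEdges hq, deleteEdges_le _, hsep, val_le_of_deleteEdges hq⟩
      · exact ⟨F, hF, le_rfl, hr, by omega⟩
    have heq := within_compl_of_isolated (F := F₁) fun x hx => hiso x (hle hx)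
    obtain ⟨h3, h4⟩ := hmain F₁ hF₁ (by rwa [heq])
    rw [heq] at h3 h4
    exact ⟨F₁, h3, h4 ▸ hv⟩

end WGraph

namespace WGraph

open SimpleGraph

variable {V : Type*} [Finite V] {M : WGraph V} {F : SimpleGraph V} {a b r u t v x y : V} {k : ℕ}

/-- An optimal forest of the reduced graph is turned into one of value one more, which is optimal by
`exists_valid_reduce`. The argument splits by whether `u` and `t` share a tree. -/
theorem Good.of_reduce (hvr : v ≠ r) (hu : M.w v u ≠ 0) (ht : M.w v t = 1)
    (hN : ∀ x, M.w v x ≠ 0 → x = u ∨ x = t) (hut : u ≠ t)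
    (hk : M.w u t = 0 → k = M.w v u) (hk' : M.w u t ≠ 0 → k = M.w u t + 1)
    (h : (M.reduce v u t k).Good r) : M.Good r := by
  obtain ⟨F, hF, hgoal⟩ := h
  have huv := (ne_of_w hu).symm
  have htv : t ≠ v := (ne_of_w (M := M) (by omega)).symm
  have hv0 : ∀ x, (M.reduce v u t k).w v x = 0 := fun _ => reduce_w_left
  have hiso : ∀ x, ¬ F.Adj v x := not_adj_of_isolated hF.1 hv0
  have hw : (M.reduce v u t k).w u t = k := reduce_w_pair huv htv hut
  have hk0 : k ≠ 0 := by
    by_cases h0 : M.w u t = 0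
    · rwa [hk h0]
    · rw [hk' h0]
      omega
  have hw0 : (M.reduce v u t k).w u t ≠ 0 := by rwa [hw]
  have hmax : ∀ {F₀}, M.Valid F₀ → (M.reduce v u t k).val F + 1 ≤ M.val F₀ → M.Optimal F₀ := by
    refine fun hF₀ hval => ⟨hF₀, fun F' hF' => ?_⟩
    obtain ⟨F'', hF'', hle⟩ := exists_valid_reduce hu ht hN hut hk hF'
    have := hF.2 F'' hF''
    omega
  have hadj : ∀ {x y}, x ≠ v → y ≠ v → M.w x y ≠ 0 → (M.reduce v u t k).graph.Adj x y := by
    intro x y hx hy hxy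
    by_cases h1 : x = u ∧ y = t
    · rw [h1.1, h1.2]
      exact hw0
    by_cases h2 : x = t ∧ y = u
    · rw [h2.1, h2.2]
      exact Adj.symm (G := (M.reduce v u t k).graph) hw0
    · change (M.reduce v u t k).w x y ≠ 0
      rwa [reduce_w hx hy h1 h2]
  by_cases hr : F.Reachable u t
  · have hFut : F.Adj u t := hF.1.closed u t hw0 hr
    have hk2 : k ≤ 2 := hw ▸ hF.1.le_two u t hFut
    have hdel := hF.1.deleteEdges hFut
    have hnr := hF.1.acyclic.not_reachable_deleteEdges hFut
    have hFdel := deleteEdges_sup_edge hFut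
    set F₁ := F.deleteEdges {s(u, t)} with hF₁
    have hiso₁ : ∀ x, ¬ F₁.Adj v x := not_adj_of_isolated hdel hv0
    have hagree : ∀ a b, a ≠ v → b ≠ v → F₁.Reachable a b → M.w a b = (M.reduce v u t k).w a b :=
      fun _ _ => reduce_agree hnr
    have hnadj : ¬ F₁.Adj u t := fun h => hnr h.reachable
    have hvalF : (M.reduce v u t k).val F =
        (M.reduce v u t k).val F₁ + if k = 1 then 1 else 0 := by
      conv_lhs => rw [← hFdel]
      rw [val_sup_edge hut hnadj, hw]
    by_cases h0 : M.w u t = 0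
    -- Series case: the edge `ut` is replaced by the path through `v`, where `vu` has the same
    -- weight as the lost edge and `vt` adds one.
    · have hku := hk h0
      have hval₂ : M.val (F₁ ⊔ edge v u) = (M.reduce v u t k).val F₁ + if k = 1 then 1 else 0 := by
        rw [val_attach hdel hv0 huv.symm hagree, hku]
      have hvalid₂ : M.Valid (F₁ ⊔ edge v u) := hdel.attach hv0 hu (hku ▸ hk2)
        (fun x hx => by
          rcases hN x hx with rfl | rfl
          exacts [Or.inl rfl, Or.inr hnr]) hagree
      have hreach₂ : ∀ {a b}, (F₁ ⊔ edge v u).Reachable a b ↔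
          F₁.Reachable (merge v u a) (merge v u b) := reachable_attach_iff hiso₁ huv.symm
      have hnr₂ : ¬ (F₁ ⊔ edge v u).Reachable v t := by
        rwa [hreach₂, merge_self, merge_of_ne htv]
      have hvalid : M.Valid (F₁ ⊔ edge v u ⊔ edge v t) := by
        refine hvalid₂.join (by omega) (by omega) hnr₂ fun a b ha hb hab => ?_
        rw [hreach₂, merge_self] at ha
        rw [hreach₂, merge_of_ne htv] at hb
        by_cases hav : a = v
        · subst hav
          refine ⟨rfl, (hN b hab).resolve_left ?_⟩
          rintro rfl
          rw [merge_of_ne huv] at hb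
          exact hnr hb
        · rw [merge_of_ne hav] at ha
          by_cases hbv : b = v
          · subst hbv
            rw [merge_self] at hb
            exact (hnr hb).elim
          rw [merge_of_ne hbv] at hb
          have hne : ¬ (a = u ∧ b = t) := by
            rintro ⟨rfl, rfl⟩
            exact hab h0
          have hne' : ¬ (a = t ∧ b = u) := by
            rintro ⟨rfl, rfl⟩
            exact hnr hb
          have hle : F₁ ≤ F := deleteEdges_le _
          have hFab := hF.1.closed a b (by rwa [reduce_w hav hbv hne hne'])
            (((ha.mono hle).trans hFut.reachable).trans (hb.mono hle).symm)
          refine (hnr ((ha.symm.trans (Adj.reachable ?_)).trans hb)).elim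
          rw [hF₁, deleteEdges_adj]
          refine ⟨hFab, ?_⟩
          simpa [Sym2.eq_iff] using ⟨fun h h' => hne ⟨h, h'⟩, fun h h' => hne' ⟨h, h'⟩⟩
      refine ⟨_, hmax hvalid ?_, ?_⟩
      · rw [val_sup_edge htv.symm fun h => hnr₂ h.reachable, hval₂, if_pos ht, hvalF]
      · rcases hgoal with ⟨x, y, hxy, h2⟩ | hp
        · left
          have hxv := (ne_of_isolated hiso hxy).1
          have hyv := (ne_of_isolated hiso hxy).2
          rw [← hFdel, sup_edge_adj_iff hut] at hxy
          have huv' : 2 ≤ k → ∃ x y, (F₁ ⊔ edge v u ⊔ edge v t).Adj x y ∧ 2 ≤ M.w x y := fun h =>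
            ⟨v, u, Or.inl ((sup_edge_adj_iff huv.symm).2 (Or.inr (Or.inl ⟨rfl, rfl⟩))), hku ▸ h⟩
          rcases hxy with hxy | ⟨rfl, rfl⟩ | ⟨rfl, rfl⟩
          · exact ⟨x, y, Or.inl (Or.inl hxy),
              (hagree x y hxv hyv hxy.reachable).symm ▸ h2⟩
          · exact huv' (hw ▸ h2)
          · rw [WGraph.symm, hw] at h2
            exact huv' h2
        · refine Or.inr (hp.transport (merge v u) (fun a b => ?_) (fun x y hxy => ?_)
            (fun x y hxy => ?_) (merge_of_ne hvr.symm))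
          · conv_rhs => rw [← hFdel]
            rw [reachable_sup_edge_iff (F := F₁ ⊔ edge v u),
              reachable_sup_edge_iff (F := F₁) (a := u) (b := t)]
            simp only [hreach₂, merge_self, merge_of_ne htv]
          · by_cases hx : x = v
            · subst hx
              rw [merge_self]
              rcases hN y hxy with rfl | rfl
              · rw [merge_of_ne huv]
                exact Or.inl (Reachable.refl _)
              · rw [merge_of_ne htv]
                exact Or.inl hr
            by_cases hy : y = v
            · subst hy
              rw [merge_self]
              rcases hN x hxy.symm with rfl | rfl
              · rw [merge_of_ne huv]
                exact Or.inl (Reachable.refl _)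
              · rw [merge_of_ne htv]
                exact Or.inl hr.symm
            · rw [merge_of_ne hx, merge_of_ne hy]
              exact Or.inr (hadj hx hy hxy)
          · have hx : x ≠ v := fun h => hxy (h ▸ reduce_w_left)
            have hy : y ≠ v := fun h => hxy (h ▸ reduce_w_right)
            by_cases h1 : x = u ∧ y = t
            · obtain ⟨rfl, rfl⟩ := h1
              refine ⟨x, v, Adj.symm (G := M.graph) hu, ?_, ?_⟩
              · rw [merge_of_ne hx]
              · rw [merge_self]
                exact hr.symm
            by_cases h2 : x = t ∧ y = u
            · obtain ⟨rfl, rfl⟩ := h2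
              refine ⟨v, y, hu, ?_, ?_⟩
              · rw [merge_self]
                exact hr.symm
              · rw [merge_of_ne hy]
            · refine ⟨x, y, ?_, ?_, ?_⟩
              · change (M.reduce v u t k).w x y ≠ 0 at hxy
                rwa [reduce_w hx hy h1 h2] at hxy
              · rw [merge_of_ne hx]
              · rw [merge_of_ne hy]
    -- Parallel case: an edge of the forest has weight at most 2, so `k = 2` and `M.w u t = 1`. The
    -- same forest gains a unit because `ut` is light again, and `v` is a pendant singleton with
    -- both neighbours in one tree.
    · have hku := hk' h0
      have hut1 : M.w u t = 1 := by omega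
      have hM : M.Valid F := by
        have hwF : ∀ x y, F.Adj x y → M.w x y ≠ 0 ∧ M.w x y ≤ 2 := by
          intro x y hxy
          have hxv := (ne_of_isolated hiso hxy).1
          have hyv := (ne_of_isolated hiso hxy).2
          have h1 := hF.1.ne_zero x y hxy
          have h2 := hF.1.le_two x y hxy
          rw [← hFdel, sup_edge_adj_iff hut] at hxy
          rcases hxy with hxy | ⟨rfl, rfl⟩ | ⟨rfl, rfl⟩
          · rw [hagree x y hxv hyv hxy.reachable]
            exact ⟨h1, h2⟩
          · omega
          · rw [M.symm]
            omega
        refine ⟨hF.1.acyclic, fun x y h => (hwF x y h).1, fun x y h => (hwF x y h).2,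
          fun x y hxy hr => hF.1.closed x y (hadj ?_ ?_ hxy) hr⟩
        · rintro rfl
          exact ne_of_w hxy (hr.eq_of_isolated hiso).symm
        · rintro rfl
          exact ne_of_w hxy (hr.symm.eq_of_isolated hiso)
      refine ⟨F, hmax hM ?_, Or.inr (hasPendant_of_isolated hiso hvr (show M.w v u ≠ 0 from hu)
        fun q q' hq hq' => ?_)⟩
      · rw [hvalF, if_neg (by omega)]
        conv_rhs => rw [← hFdel]
        rw [val_sup_edge hut hnadj, if_pos hut1]
        refine Nat.add_le_add_right (le_of_eq (val_congr fun a b h => ?_)) 1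
        exact (hagree a b (ne_of_isolated hiso₁ h).1 (ne_of_isolated hiso₁ h).2 h.reachable).symm
      · rcases hN q hq with rfl | rfl <;> rcases hN q' hq' with rfl | rfl
        exacts [Reachable.refl _, hr, hr.symm, Reachable.refl _]
  -- The trees of `u` and `t` differ, so `v` hangs on `t` by its light edge; the edge `vu` then
  -- joins the same two trees as `ut` does in the reduced graph.
  · have hagree : ∀ a b, a ≠ v → b ≠ v → F.Reachable a b → M.w a b = (M.reduce v u t k).w a b :=
      fun _ _ => reduce_agree hr
    refine ⟨F ⊔ edge v t, hmax (hF.1.attach hv0 (by omega) (by omega) (fun x hx => ?_) hagree) ?_,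
      ?_⟩
    · rcases hN x hx with rfl | rfl
      exacts [Or.inr fun h => hr h.symm, Or.inl rfl]
    · rw [val_attach hF.1 hv0 htv.symm hagree, if_pos ht]
    · rcases hgoal with ⟨x, y, hxy, h2⟩ | hp
      · refine Or.inl ⟨x, y, Or.inl hxy, ?_⟩
        rwa [hagree x y (ne_of_isolated hiso hxy).1 (ne_of_isolated hiso hxy).2 hxy.reachable]
      · refine Or.inr (hp.transport (merge v t) (fun a b => reachable_attach_iff hiso htv.symm)
          (fun x y hxy => ?_) (fun x y hxy => ?_) (merge_of_ne hvr.symm))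
        · have hut' : (M.reduce v u t k).graph.Adj u t := by
            change (M.reduce v u t k).w u t ≠ 0
            rwa [hw]
          by_cases hx : x = v
          · subst hx
            rw [merge_self]
            rcases hN y hxy with rfl | rfl
            · rw [merge_of_ne huv]
              exact Or.inr hut'.symm
            · rw [merge_of_ne htv]
              exact Or.inl (Reachable.refl _)
          by_cases hy : y = v
          · subst hy
            rw [merge_self]
            rcases hN x hxy.symm with rfl | rfl
            · rw [merge_of_ne huv]
              exact Or.inr hut'
            · rw [merge_of_ne htv]
              exact Or.inl (Reachable.refl _)
          · rw [merge_of_ne hx, merge_of_ne hy]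
            exact Or.inr (hadj hx hy hxy)
        · have hx : x ≠ v := fun h => hxy (h ▸ reduce_w_left)
          have hy : y ≠ v := fun h => hxy (h ▸ reduce_w_right)
          by_cases h1 : x = u ∧ y = t
          · obtain ⟨rfl, rfl⟩ := h1
            refine ⟨x, v, Adj.symm (G := M.graph) hu, ?_, ?_⟩
            · rw [merge_of_ne hx]
            · rw [merge_self]
          by_cases h2 : x = t ∧ y = u
          · obtain ⟨rfl, rfl⟩ := h2
            refine ⟨v, y, hu, ?_, ?_⟩
            · rw [merge_self]
            · rw [merge_of_ne hy]
          · refine ⟨x, y, ?_, ?_, ?_⟩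
            · change (M.reduce v u t k).w x y ≠ 0 at hxy
              rwa [reduce_w hx hy h1 h2] at hxy
            · rw [merge_of_ne hx]
            · rw [merge_of_ne hy]

end WGraph

/-! ### Splitting at a cut vertex with heavy edges -/

namespace WGraph

open SimpleGraph

variable {V : Type*} {M : WGraph V} {F F₁ F₂ H : SimpleGraph V} {U : Set V}
  {a b r u t v x y : V} {k : ℕ}

/-- A walk that starts in `U` can use no edge of `F₂`. The subgraph `H` is kept in the conclusion so
that the lemma also applies after deleting an edge, as acyclicity requires. -/
theorem reachable_of_split (h₁ : ∀ x y, F₁.Adj x y → x ∈ U) (h₂ : ∀ x y, F₂.Adj x y → x ∉ U)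
    (hH : H ≤ F₁ ⊔ F₂) (hx : x ∈ U) (h : H.Reachable x y) : (F₁ ⊓ H).Reachable x y ∧ y ∈ U := by
  refine h.induction_on (P := fun y => (F₁ ⊓ H).Reachable x y ∧ y ∈ U)
    ⟨Reachable.refl _, hx⟩ fun p q _ hp hpq => ?_
  rcases hH hpq with h | h
  · exact ⟨hp.1.trans (Adj.reachable ⟨h, hpq⟩), h₁ q p h.symm⟩
  · exact (h₂ p q h hp.2).elim

theorem acyclic_of_split (h₁ : ∀ x y, F₁.Adj x y → x ∈ U) (h₂ : ∀ x y, F₂.Adj x y → x ∉ U)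
    (hF₁ : F₁.IsAcyclic) (hF₂ : F₂.IsAcyclic) : (F₁ ⊔ F₂).IsAcyclic := by
  have hle : ∀ (F F' : SimpleGraph V) (e : Set (Sym2 V)), F ⊓ (F').deleteEdges e ≤ F.deleteEdges e :=
    fun F F' e x y h => by
      have h2 := h.2
      rw [deleteEdges_adj] at h2 ⊢
      exact ⟨h.1, h2.2⟩
  rw [isAcyclic_iff_forall_adj_isBridge]
  intro a b hab
  rw [isBridge_iff]
  intro hr
  rcases hab with hab | hab
  · exact hF₁.not_reachable_deleteEdges hab
      ((reachable_of_split h₁ h₂ (deleteEdges_le _) (h₁ a b hab) hr).1.mono (hle _ _ _))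
  · refine hF₂.not_reachable_deleteEdges hab
      ((reachable_of_split (U := Uᶜ) h₂ (fun x y h h' => h' (h₁ x y h)) ?_ (h₂ a b hab) hr).1.mono
        (hle _ _ _))
    rw [sup_comm]
    exact deleteEdges_le _

theorem val_sup_of_split [Finite V] (h₁ : ∀ x y, F₁.Adj x y → x ∈ U)
    (h₂ : ∀ x y, F₂.Adj x y → x ∉ U) : M.val (F₁ ⊔ F₂) = M.val F₁ + M.val F₂ := by
  unfold val
  rw [edgeSet_sup, Set.union_inter_distrib_right]
  refine Set.ncard_union_eq (Set.disjoint_left.2 fun e h h' => ?_) (Set.toFinite _) (Set.toFinite _)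
  induction e with
  | _ x y => exact h₂ x y h'.1 (h₁ x y h.1)

/-- The vertex `v` has only edges of weight at least three, and one of them leads to a part `U` of
the graph that has no other connection to the rest: then an optimal forest may be chosen
independently on `U ∪ {v}`. -/
theorem Good.of_split [Finite V] (hv : v ∉ U) (hrU : r ∉ U) (h3 : ∀ x, M.w v x ≠ 0 → 3 ≤ M.w v x)
    (hU : ∀ x y, x ∈ U → M.w x y ≠ 0 → y ≠ v → y ∈ U)
    (h : (M.within (insert v U)).Good v) : M.Good r := by
  obtain ⟨F₁, hF₁, hgoal⟩ := h
  obtain ⟨F₂, hF₂⟩ : ∃ F₂, (M.outside (insert v U)).Optimal F₂ := exists_optimal _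
  have hw1 : ∀ {x y}, x ∈ insert v U → y ∈ insert v U →
      (M.within (insert v U)).w x y = M.w x y := fun hx hy => within_w_of_mem hx hy
  have hw2 : ∀ {x y}, ¬ (x ∈ insert v U ∧ y ∈ insert v U) →
      (M.outside (insert v U)).w x y = M.w x y := fun h => if_neg h
  have hw2' : ∀ {x y}, (M.outside (insert v U)).w x y ≠ 0 →
      ¬ (x ∈ insert v U ∧ y ∈ insert v U) := fun h h' => h (if_pos h')
  have hlight : ∀ {x y}, M.w x y ≠ 0 → M.w x y ≤ 2 → x ≠ v := by
    rintro x y h h' rfl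
    have := h3 y h
    omega
  have hlight' : ∀ {x y}, M.w x y ≠ 0 → M.w x y ≤ 2 → y ≠ v := fun h h' =>
    hlight (by rwa [M.symm]) (by rwa [M.symm])
  have he1 : ∀ x y, F₁.Adj x y → (M.w x y ≠ 0 ∧ M.w x y ≤ 2) ∧ x ∈ U ∧ y ∈ U := by
    intro x y hxy
    have h0 := hF₁.1.ne_zero x y hxy
    have h2 := hF₁.1.le_two x y hxy
    obtain ⟨hx, hy⟩ := mem_of_within_w h0
    rw [hw1 hx hy] at h0 h2
    exact ⟨⟨h0, h2⟩, hx.resolve_left (hlight h0 h2), hy.resolve_left (hlight' h0 h2)⟩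
  have he2 : ∀ x y, F₂.Adj x y → (M.w x y ≠ 0 ∧ M.w x y ≤ 2) ∧ x ∉ U := by
    intro x y hxy
    have h0 := hF₂.1.ne_zero x y hxy
    have h2 := hF₂.1.le_two x y hxy
    have hn := hw2' h0
    rw [hw2 hn] at h0 h2
    exact ⟨⟨h0, h2⟩, fun hx => hn ⟨Or.inr hx, Or.inr (hU x y hx h0 (hlight' h0 h2))⟩⟩
  have hs1 : ∀ x y, F₁.Adj x y → x ∈ U := fun x y h => (he1 x y h).2.1
  have hs2 : ∀ x y, F₂.Adj x y → x ∉ U := fun x y h => (he2 x y h).2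
  have hr1 : ∀ {x y}, x ∈ U → (F₁ ⊔ F₂).Reachable x y → F₁.Reachable x y ∧ y ∈ U := by
    intro x y hx h
    have := reachable_of_split hs1 hs2 le_rfl hx h
    exact ⟨this.1.mono inf_le_left, this.2⟩
  have hr2 : ∀ {x y}, x ∉ U → (F₁ ⊔ F₂).Reachable x y → F₂.Reachable x y ∧ y ∉ U := by
    intro x y hx h
    have := reachable_of_split (U := Uᶜ) hs2 (fun x y h h' => h' (hs1 x y h))
      (sup_comm F₁ F₂).le hx h
    exact ⟨this.1.mono inf_le_left, this.2⟩
  have hvalid : M.Valid (F₁ ⊔ F₂) := by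
    refine ⟨acyclic_of_split hs1 hs2 hF₁.1.acyclic hF₂.1.acyclic, fun x y h => ?_,
      fun x y h => ?_, fun x y hxy hr => ?_⟩
    · exact h.elim (fun h => (he1 x y h).1.1) (fun h => (he2 x y h).1.1)
    · exact h.elim (fun h => (he1 x y h).1.2) (fun h => (he2 x y h).1.2)
    · by_cases hx : x ∈ U
      · obtain ⟨hr, hy⟩ := hr1 hx hr
        exact Or.inl (hF₁.1.closed x y (by rwa [hw1 (Or.inr hx) (Or.inr hy)]) hr)
      · obtain ⟨hr, hy⟩ := hr2 hx hr
        refine Or.inr (hF₂.1.closed x y ?_ hr)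
        rwa [hw2]
        rintro ⟨h, h'⟩
        exact ne_of_w hxy ((h.resolve_right hx).trans (h'.resolve_right hy).symm)
  have hopt : M.Optimal (F₁ ⊔ F₂) := by
    refine ⟨hvalid, fun F hF => ?_⟩
    -- Every edge at `v` is too heavy for a valid forest, and `v` is the only way out of `U`, so no
    -- forest edge leaves `U`.
    have hFe : ∀ x y, F.Adj x y → (x ∈ U ↔ y ∈ U) := fun x y h =>
      have h0 := hF.ne_zero x y h
      have h2 := hF.le_two x y h
      ⟨fun hx => hU x y hx h0 (hlight' h0 h2),
        fun hy => hU y x hy (by rwa [M.symm]) (hlight h0 h2)⟩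
    have hFv : ∀ x y, F.Adj x y → x ∈ insert v U → x ∈ U := fun x y h hx =>
      hx.resolve_left (hlight (hF.ne_zero x y h) (hF.le_two x y h))
    have hv1 : (M.within (insert v U)).Valid (F.within U) := by
      refine ⟨hF.acyclic.anti within_le, fun x y h => ?_, fun x y h => ?_, fun x y hxy hr => ?_⟩
      · rw [hw1 (Or.inr h.2.1) (Or.inr h.2.2)]
        exact hF.ne_zero x y h.1
      · rw [hw1 (Or.inr h.2.1) (Or.inr h.2.2)]
        exact hF.le_two x y h.1
      · obtain ⟨hx, hy⟩ := mem_of_within_w hxy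
        rw [hw1 hx hy] at hxy
        have := hF.closed x y hxy (hr.mono within_le)
        exact ⟨this, hFv x y this hx, hFv y x this.symm hy⟩
    have hn : ∀ {x y}, F.Adj x y → x ∈ Uᶜ → ¬ (x ∈ insert v U ∧ y ∈ insert v U) :=
      fun h hx h' => hx (hFv _ _ h h'.1)
    have hv2 : (M.outside (insert v U)).Valid (F.within Uᶜ) := by
      refine ⟨hF.acyclic.anti within_le, fun x y h => ?_, fun x y h => ?_, fun x y hxy hr => ?_⟩
      · rw [hw2 (hn h.1 h.2.1)]
        exact hF.ne_zero x y h.1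
      · rw [hw2 (hn h.1 h.2.1)]
        exact hF.le_two x y h.1
      · have hne := hw2' hxy
        rw [hw2 hne] at hxy
        have := hF.closed x y hxy (hr.mono within_le)
        by_cases hx : x ∈ U
        · exact (hne ⟨Or.inr hx, Or.inr ((hFe x y this).1 hx)⟩).elim
        · exact ⟨this, hx, fun hy => hx ((hFe x y this).2 hy)⟩
    have hsplit : F = F.within U ⊔ F.within Uᶜ := by
      ext x y
      refine ⟨fun h => ?_, fun h => h.elim (fun h => h.1) (fun h => h.1)⟩
      by_cases hx : x ∈ U
      · exact Or.inl ⟨h, hx, (hFe x y h).1 hx⟩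
      · exact Or.inr ⟨h, hx, fun hy => hx ((hFe x y h).2 hy)⟩
    rw [hsplit, val_sup_of_split (F₁ := F.within U) (F₂ := F.within Uᶜ) (U := U)
      (fun x y h => h.2.1) (fun x y h => h.2.1),
      val_sup_of_split hs1 hs2]
    have e1 : M.val (F.within U) = (M.within (insert v U)).val (F.within U) :=
      val_congr fun x y h => (hw1 (Or.inr h.2.1) (Or.inr h.2.2)).symm
    have e2 : M.val (F.within Uᶜ) = (M.outside (insert v U)).val (F.within Uᶜ) :=
      val_congr fun x y h => (hw2 (hn h.1 h.2.1)).symm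
    have e3 : M.val F₁ = (M.within (insert v U)).val F₁ :=
      val_congr fun x y h => (hw1 (Or.inr (he1 x y h).2.1) (Or.inr (he1 x y h).2.2)).symm
    have e4 : M.val F₂ = (M.outside (insert v U)).val F₂ :=
      val_congr fun x y h => (hw2 (hw2' (hF₂.1.ne_zero x y h))).symm
    rw [e1, e2, e3, e4]
    exact Nat.add_le_add (hF₁.2 _ hv1) (hF₂.2 _ hv2)
  refine ⟨_, hopt, hgoal.imp ?_ ?_⟩
  · rintro ⟨x, y, hxy, h2⟩
    exact ⟨x, y, Or.inl hxy, h2.trans (within_w_le x y)⟩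
  -- The pendant tree avoids the root `v` and so lies inside `U`; all edges leaving it are already
  -- present in the part on `insert v U`. It avoids `r` because `r` is outside `U`.
  · rintro ⟨x, hxv, ⟨p, q, hxp, hpq, hxq⟩, huniq⟩
    have hx : x ∈ U := by
      have hp : p ∈ U := (mem_of_within_w hpq).1.resolve_left fun h => hxv (h ▸ hxp)
      exact (hr1 hp (hxp.symm.mono le_sup_left)).2
    have hiff : ∀ z, (F₁ ⊔ F₂).Reachable x z ↔ F₁.Reachable x z := fun z =>
      ⟨fun h => (hr1 hx h).1, fun h => h.mono le_sup_left⟩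
    have hadj : ∀ p q, F₁.Reachable x p → M.graph.Adj p q →
        (M.within (insert v U)).graph.Adj p q := by
      intro p q hp hpq
      have hpU : p ∈ U := (hr1 hx (hp.mono le_sup_left)).2
      change (M.within (insert v U)).w p q ≠ 0
      rw [hw1 (Or.inr hpU)]
      · exact hpq
      · by_cases hq : q = v
        · exact Or.inl hq
        · exact Or.inr (hU p q hpU hpq hq)
    refine ⟨x, fun h => hrU (hr1 hx h).2, ⟨p, q, (hiff p).2 hxp, ?_, fun h => hxq ((hiff q).1 h)⟩,
      fun p q p' q' h1 h2 h3 h4 h5 h6 => ?_⟩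
    · obtain ⟨h, h'⟩ := mem_of_within_w hpq
      change (M.within (insert v U)).w p q ≠ 0 at hpq
      rwa [hw1 h h'] at hpq
    · rw [hiff] at h1 h3 h4 h6
      exact (huniq p q p' q' h1 (hadj p q h1 h2) h3 h4 (hadj p' q' h4 h5) h6).mono le_sup_left

end WGraph

/-! ### The induction on weighted graphs -/

namespace WGraph

open SimpleGraph

variable {V : Type*} {M M' : WGraph V} {r u t v : V} {k : ℕ}

/-- The multigraph with the given weights as multiplicities contains a cycle. -/
def Cyclic (M : WGraph V) : Prop :=
  ¬ M.graph.IsAcyclic ∨ ∃ x y, 2 ≤ M.w x y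

theorem Cyclic.within_compl (h : M.Cyclic) (hu : M.w v u = 1)
    (hN : ∀ x, M.w v x ≠ 0 → x = u) : (M.within {v}ᶜ).Cyclic := by
  by_contra hc
  obtain ⟨hac, hlight⟩ := not_or.1 hc
  rw [not_not] at hac
  have hvu : v ≠ u := ne_of_w (M := M) (by omega)
  have hv : ∀ x, M.w v x ≤ 1 := fun x => by
    by_cases hx : M.w v x = 0
    · omega
    · rw [hN x hx]; omega
  rcases h with h | ⟨x, y, hxy⟩
  · refine h ((hac.sup_edge_of_not_reachable (u := v) (v := u) fun hr => hvu ?_).anti ?_)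
    · exact (hr.eq_of_isolated fun x hx => hx within_compl_w_left).symm
    · intro x y hxy
      rw [sup_edge_adj_iff hvu]
      by_cases hx : x = v
      · subst hx
        exact Or.inr (Or.inl ⟨rfl, hN y hxy⟩)
      by_cases hy : y = v
      · subst hy
        exact Or.inr (Or.inr ⟨hN x hxy.symm, rfl⟩)
      · refine Or.inl ?_
        change (M.within {v}ᶜ).w x y ≠ 0
        rwa [within_compl_w hx hy]
  · refine hlight ⟨x, y, ?_⟩
    rwa [within_compl_w]
    · rintro rfl
      have := hv y
      omega
    · rintro rfl
      have := hv x
      rw [M.symm] at hxy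
      omega

/-- If the reduced multigraph were a forest, then `k = 1`, which rules out the parallel case;
undoing a series reduction only subdivides an edge of a forest, with all weights 1, and gives a
forest again. -/
theorem Cyclic.reduce (h : M.Cyclic) (hu : M.w v u ≠ 0) (ht : M.w v t = 1)
    (hN : ∀ x, M.w v x ≠ 0 → x = u ∨ x = t) (hut : u ≠ t)
    (hk : M.w u t = 0 → k = M.w v u) (hk' : M.w u t ≠ 0 → k = M.w u t + 1) :
    (M.reduce v u t k).Cyclic := by
  by_contra hc
  obtain ⟨hac, hlight⟩ := not_or.1 hc
  rw [not_not] at hac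
  have huv := (ne_of_w hu).symm
  have htv : t ≠ v := (ne_of_w (M := M) (by omega)).symm
  have hw : (M.reduce v u t k).w u t = k := reduce_w_pair huv htv hut
  have hk1 : k ≤ 1 := by
    by_contra hk1
    exact hlight ⟨u, t, by omega⟩
  have h0 : M.w u t = 0 := by
    by_contra h0
    have := hk' h0
    omega
  have hku := hk h0
  have hv : ∀ x, M.w v x ≤ 1 := fun x => by
    by_cases hx : M.w v x = 0
    · omega
    · rcases hN x hx with rfl | rfl <;> omega
  rcases h with h | ⟨x, y, hxy⟩
  · have hadj : (M.reduce v u t k).graph.Adj u t := by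
      change (M.reduce v u t k).w u t ≠ 0
      omega
    have hnr := hac.not_reachable_deleteEdges hadj
    have hle := deleteEdges_le (G := (M.reduce v u t k).graph) {s(u, t)}
    have hiso : ∀ x, ¬ ((M.reduce v u t k).graph.deleteEdges {s(u, t)}).Adj v x :=
      fun x hx => hle hx reduce_w_left
    refine h (((((hac.anti hle).sup_edge_of_not_reachable (u := v) (v := u)
      fun hr => ?_).sup_edge_of_not_reachable (u := v) (v := t) fun hr => ?_)).anti ?_)
    · exact huv (hr.eq_of_isolated hiso)
    · rw [reachable_attach_iff hiso huv.symm, merge_self, merge_of_ne htv] at hr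
      exact hnr hr
    · intro x y hxy
      rw [sup_edge_adj_iff htv.symm, sup_edge_adj_iff huv.symm]
      by_cases hx : x = v
      · subst hx
        rcases hN y hxy with rfl | rfl <;> simp
      by_cases hy : y = v
      · subst hy
        rcases hN x hxy.symm with rfl | rfl <;> simp
      have hne : ¬ (x = u ∧ y = t) := by
        rintro ⟨rfl, rfl⟩
        exact hxy h0
      have hne' : ¬ (x = t ∧ y = u) := by
        rintro ⟨rfl, rfl⟩
        exact hxy ((M.symm _ _).trans h0)
      refine Or.inl (Or.inl ?_)
      rw [deleteEdges_adj]
      refine ⟨?_, ?_⟩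
      · change (M.reduce v u t k).w x y ≠ 0
        rwa [reduce_w hx hy hne hne']
      · simpa [Sym2.eq_iff] using ⟨fun h h' => hne ⟨h, h'⟩, fun h h' => hne' ⟨h, h'⟩⟩
  · refine hlight ⟨x, y, ?_⟩
    rwa [reduce_w]
    · rintro rfl
      have := hv y
      omega
    · rintro rfl
      have := hv x
      rw [M.symm] at hxy
      omega
    · rintro ⟨rfl, rfl⟩
      omega
    · rintro ⟨rfl, rfl⟩
      rw [M.symm] at hxy
      omega

variable [Finite V]

theorem good_of_light_edge (hK4 : ¬ M.graph.HasK4Minor) (hK23 : ¬ M.HasK23) (hc : M.Cyclic)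
    (ih : ∀ M' : WGraph V, M'.graph.support.ncard < M.graph.support.ncard →
      ¬ M'.graph.HasK4Minor → ¬ M'.HasK23 → M'.Cyclic → ∀ r, M'.Good r)
    (hvr : v ≠ r) (hu : M.w v u ≠ 0) (ht : M.w v t = 1)
    (hN : ∀ x, M.w v x ≠ 0 → x = u ∨ x = t) (hut : u ≠ t) : M.Good r := by
  have ht0 : M.w v t ≠ 0 := by omega
  obtain ⟨k, hk, hk'⟩ : ∃ k, (M.w u t = 0 → k = M.w v u) ∧ (M.w u t ≠ 0 → k = M.w u t + 1) := by
    by_cases h0 : M.w u t = 0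
    · exact ⟨_, fun _ => rfl, fun h => (h h0).elim⟩
    · exact ⟨_, fun h => (h0 h).elim, fun _ => rfl⟩
  refine Good.of_reduce hvr hu ht hN hut hk hk' (ih _ ?_ ?_ ?_ (hc.reduce hu ht hN hut hk hk') r)
  · refine Set.ncard_lt_ncard ?_ (Set.toFinite _)
    have hsub : (M.reduce v u t k).graph.support ⊆ M.graph.support \ {v} := fun x ⟨y, hxy⟩ =>
      support_contract_subset (G := M.graph) hu ⟨y, reduce_graph_le ht0 hxy⟩
    exact ⟨hsub.trans Set.sdiff_subset, fun h => (hsub (h ⟨u, hu⟩)).2 rfl⟩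
  · exact fun h => hK4 ((h.mono (reduce_graph_le ht0)).of_contract hu)
  · intro h
    by_cases h0 : M.w u t = 0
    · refine hK23 (HasK23.of_reduce_series hu ht0 hut ?_)
      rwa [max_eq_left (by omega), ← hk h0]
    · exact hK23 (HasK23.of_reduce_parallel hu ht0 h0 (hk' h0 ▸ h))

/-- An edge of weight 2 is worth nothing, so adding it to an optimal forest keeps it optimal. It may
be added because `u` and `t` lie in different trees. -/
theorem good_of_weight_two {F : SimpleGraph V} (hF : (M.within {v}ᶜ).Optimal F)
    (hu : M.w v u = 2) (ht : 2 ≤ M.w v t) (hN : ∀ x, M.w v x ≠ 0 → x = u ∨ x = t)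
    (hr : ¬ F.Reachable u t) : M.Good r := by
  have hvu : v ≠ u := ne_of_w (M := M) (by omega)
  have hagree : ∀ a b, a ≠ v → b ≠ v → F.Reachable a b → M.w a b = (M.within {v}ᶜ).w a b :=
    fun a b ha hb _ => (within_compl_w ha hb).symm
  have hopt : M.Optimal F := hF.of_within_compl fun x hx => by
    rcases hN x (by omega) with rfl | rfl <;> omega
  refine ⟨F ⊔ edge v u, ⟨hF.1.attach (fun _ => within_compl_w_left) (by omega) (by omega)
    (fun x hx => ?_) hagree, fun F' hF' => ?_⟩,
    Or.inl ⟨v, u, (sup_edge_adj_iff hvu).2 (Or.inr (Or.inl ⟨rfl, rfl⟩)), by omega⟩⟩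
  · rcases hN x hx with rfl | rfl
    exacts [Or.inl rfl, Or.inr hr]
  · rw [val_attach hF.1 (fun _ => within_compl_w_left) hvu hagree, ← val_of_within_compl hF.1]
    exact (hopt.2 F' hF').trans (Nat.le_add_right _ _)

/-- The set split off is the part of `u` after removal of `v`. With `v` added it is smaller since it
lacks `t`, and it is cyclic since it keeps the heavy edge `vu`. -/
theorem good_of_component (hK4 : ¬ M.graph.HasK4Minor) (hK23 : ¬ M.HasK23)
    (ih : ∀ M' : WGraph V, M'.graph.support.ncard < M.graph.support.ncard →
      ¬ M'.graph.HasK4Minor → ¬ M'.HasK23 → M'.Cyclic → ∀ r, M'.Good r)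
    (hu : 3 ≤ M.w v u) (ht : 3 ≤ M.w v t) (hN : ∀ x, M.w v x ≠ 0 → x = u ∨ x = t)
    (hut : ¬ (M.graph.within {v}ᶜ).Reachable u t)
    (hr : ¬ (M.graph.within {v}ᶜ).Reachable u r) : M.Good r := by
  have huv : u ≠ v := (ne_of_w (M := M) (by omega)).symm
  have htv : t ≠ v := (ne_of_w (M := M) (by omega)).symm
  refine Good.of_split (U := {x | (M.graph.within {v}ᶜ).Reachable u x})
    (fun h => Reachable.mem_of_within h huv rfl) hr (fun x hx => ?_) (fun x y hx hxy hy => ?_)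
    (ih _ ?_ ?_ ?_ (Or.inr ⟨v, u, ?_⟩) v)
  · rcases hN x hx with rfl | rfl <;> assumption
  · exact Reachable.trans hx (Adj.reachable ⟨hxy, Reachable.mem_of_within hx huv, hy⟩)
  · refine Set.ncard_lt_ncard ⟨fun x ⟨y, hxy⟩ => ⟨y, graph_mono within_w_le hxy⟩, fun h => ?_⟩
      (Set.toFinite _)
    obtain ⟨y, hy⟩ := h (show t ∈ M.graph.support from
      ⟨v, Adj.symm (G := M.graph) (show M.w v t ≠ 0 by omega)⟩)
    exact (mem_of_within_w hy).1.elim htv hut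
  · exact fun h => hK4 (h.mono (graph_mono within_w_le))
  · exact fun h => hK23 (h.mono within_w_le)
  · have hmem : u ∈ {x | (M.graph.within {v}ᶜ).Reachable u x} := Reachable.refl u
    rw [within_w_of_mem (Set.mem_insert _ _) (Set.mem_insert_of_mem _ hmem)]
    omega

theorem good_of_cyclic (M : WGraph V) (hK4 : ¬ M.graph.HasK4Minor) (hK23 : ¬ M.HasK23)
    (hc : M.Cyclic) (r : V) : M.Good r := by
  induction hn : M.graph.support.ncard using Nat.strong_induction_on generalizing M r with
  | _ n ih =>
  replace ih : ∀ M' : WGraph V, M'.graph.support.ncard < M.graph.support.ncard →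
      ¬ M'.graph.HasK4Minor → ¬ M'.HasK23 → M'.Cyclic → ∀ r, M'.Good r :=
    fun M' hlt h1 h2 h3 r => ih _ (hn ▸ hlt) M' h1 h2 h3 r rfl
  have hne : M.graph ≠ ⊥ := by
    intro h0
    rcases hc with hc | ⟨x, y, hxy⟩
    · exact hc (h0 ▸ isAcyclic_bot)
    · have : M.graph.Adj x y := show M.w x y ≠ 0 by omega
      rw [h0] at this
      exact this.elim
  obtain ⟨v, ⟨u₀, hvu₀⟩, hvr, hdeg⟩ := exists_degree_le_two hK4 hne r
  have hpos : 0 < (M.graph.neighborSet v).ncard :=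
    (Set.ncard_pos (Set.toFinite _)).2 ⟨u₀, hvu₀⟩
  obtain h1 | h2 : (M.graph.neighborSet v).ncard = 1 ∨ (M.graph.neighborSet v).ncard = 2 := by
    omega
  · obtain ⟨u, hu⟩ := Set.ncard_eq_one.1 h1
    have hN : ∀ x, M.w v x ≠ 0 → x = u := fun x hx => by
      have : x ∈ M.graph.neighborSet v := hx
      rwa [hu] at this
    have hvu : M.w v u ≠ 0 := by
      have : u ∈ M.graph.neighborSet v := by rw [hu]; rfl
      exact this
    by_cases hlight : M.w v u = 1
    · refine Good.of_light_leaf hvr hlight hN (ih _ ?_ ?_ ?_ (hc.within_compl hlight hN) r)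
      · refine Set.ncard_lt_ncard ⟨fun x ⟨y, hxy⟩ => ⟨y, graph_mono within_w_le hxy⟩, fun h => ?_⟩
          (Set.toFinite _)
        obtain ⟨y, hy⟩ := h (show v ∈ M.graph.support from ⟨u, hvu⟩)
        exact hy within_compl_w_left
      · exact fun h => hK4 (h.mono (graph_mono within_w_le))
      · exact fun h => hK23 (h.mono within_w_le)
    · exact good_of_heavy_leaf hvr (by omega) hN
  · obtain ⟨u, t, hut, hu⟩ := Set.ncard_eq_two.1 h2
    have hN : ∀ x, M.w v x ≠ 0 → x = u ∨ x = t := fun x hx => by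
      have : x ∈ M.graph.neighborSet v := hx
      rwa [hu] at this
    have hvu : M.w v u ≠ 0 := by
      have : u ∈ M.graph.neighborSet v := by rw [hu]; simp
      exact this
    have hvt : M.w v t ≠ 0 := by
      have : t ∈ M.graph.neighborSet v := by rw [hu]; simp
      exact this
    by_cases ht1 : M.w v t = 1
    · exact good_of_light_edge hK4 hK23 hc ih hvr hvu ht1 hN hut
    by_cases hu1 : M.w v u = 1
    · exact good_of_light_edge hK4 hK23 hc ih hvr hvt hu1 (fun x hx => (hN x hx).symm) hut.symm
    obtain ⟨F, hF⟩ := (M.within {v}ᶜ).exists_optimal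
    by_cases hr : F.Reachable u t
    · refine ⟨F, hF.of_within_compl fun x hx => ?_, Or.inr (hasPendant_of_isolated
        (not_adj_of_isolated hF.1 fun _ => within_compl_w_left) hvr
        (show M.w v u ≠ 0 from hvu) fun q q' hq hq' => ?_)⟩
      · rcases hN x (by omega) with rfl | rfl <;> omega
      · rcases hN q hq with rfl | rfl <;> rcases hN q' hq' with rfl | rfl
        exacts [Reachable.refl _, hr, hr.symm, Reachable.refl _]
    by_cases hu2 : M.w v u = 2
    · exact good_of_weight_two hF hu2 (by omega) hN hr
    by_cases ht2 : M.w v t = 2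
    · exact good_of_weight_two hF ht2 (by omega) (fun x hx => (hN x hx).symm) fun h => hr h.symm
    -- Both weights are at least 3 now, so a second route from `u` to `t` would be the third
    -- connection of a K_{2,3}. Hence `r` is on at most one of the two sides.
    have hsep : ¬ (M.graph.within {v}ᶜ).Reachable u t := fun h =>
      hK23 (hasK23_of_three_le (show 3 ≤ M.w v u by omega) hvt hut.symm h.symm)
    by_cases hru : (M.graph.within {v}ᶜ).Reachable u r
    · exact good_of_component hK4 hK23 ih (by omega) (by omega) (fun x hx => (hN x hx).symm)
        (fun h => hsep h.symm) fun h => hsep (hru.trans h.symm)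
    · exact good_of_component hK4 hK23 ih (by omega) (by omega) hN hsep hru

end WGraph

/-! ### Tree coverings as induced forests -/

namespace SimpleGraph

variable {V : Type*} {F G : SimpleGraph V} {a b x y : V} {T : Set V} {𝒮 : Set (Set V)}

theorem card_connectedComponent_deleteEdges [Finite V] (hF : F.IsAcyclic) (hab : F.Adj a b) :
    Nat.card (F.deleteEdges {s(a, b)}).ConnectedComponent =
      Nat.card F.ConnectedComponent + 1 := by
  have hnr := hF.not_reachable_deleteEdges hab
  have hsup := deleteEdges_sup_edge hab
  set F₁ := F.deleteEdges {s(a, b)}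
  have hle : F₁ ≤ F := hsup ▸ le_sup_left
  classical
  -- Putting the edge back merges the components of `a` and `b`, so omitting that of `b` leaves a
  -- bijection onto the components of `F`.
  have hbij : Function.Bijective
      (fun c : {c : F₁.ConnectedComponent // c ≠ F₁.connectedComponentMk b} =>
        c.1.map (Hom.ofLE hle)) := by
    constructor
    · rintro ⟨c, hc⟩ ⟨d, hd⟩ h
      induction c using ConnectedComponent.ind with | _ x =>
      induction d using ConnectedComponent.ind with | _ y =>
      simp only [ne_eq, ConnectedComponent.eq] at hc hd
      have h' : F.Reachable x y := ConnectedComponent.eq.1 h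
      rw [← hsup, reachable_sup_edge_iff] at h'
      refine Subtype.ext (ConnectedComponent.eq.2 ?_)
      rcases h' with h' | h' | h'
      · exact h'
      · exact (hd h'.2.symm).elim
      · exact (hc h'.1).elim
    · intro c
      induction c using ConnectedComponent.ind with | _ x =>
      by_cases hx : F₁.Reachable x b
      · refine ⟨⟨F₁.connectedComponentMk a, fun h => hnr (ConnectedComponent.eq.1 h)⟩, ?_⟩
        exact ConnectedComponent.eq.2 (hab.reachable.trans (hx.mono hle).symm)
      · exact ⟨⟨F₁.connectedComponentMk x, fun h => hx (ConnectedComponent.eq.1 h)⟩, rfl⟩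
  rw [← Nat.card_congr (Equiv.ofBijective _ hbij), ← Finite.card_option]
  exact (Nat.card_congr (Equiv.optionSubtypeNe _)).symm

theorem IsAcyclic.card_connectedComponent_add_ncard_edgeSet [Finite V] (hF : F.IsAcyclic) :
    Nat.card F.ConnectedComponent + F.edgeSet.ncard = Nat.card V := by
  induction hn : F.edgeSet.ncard generalizing F with
  | zero =>
    have hF0 : F = ⊥ := edgeSet_eq_empty.1 ((Set.ncard_eq_zero (Set.toFinite _)).1 hn)
    subst hF0
    refine (Nat.card_congr (Equiv.ofBijective (connectedComponentMk ⊥) ⟨fun x y h => ?_,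
      fun c => c.ind fun x => ⟨x, rfl⟩⟩)).symm
    exact ((ConnectedComponent.eq.1 h).eq_of_isolated fun _ h => h.elim).symm
  | succ n ih =>
    obtain ⟨e, he⟩ := (Set.ncard_pos (Set.toFinite F.edgeSet)).1 (by omega)
    induction e with
    | _ a b =>
      have h1 := card_connectedComponent_deleteEdges (a := a) (b := b) hF he
      have h2 : (F.deleteEdges {s(a, b)}).edgeSet.ncard = n := by
        rw [edgeSet_deleteEdges, Set.ncard_sdiff_singleton_of_mem he, hn]
        rfl
      have := ih (hF.anti (deleteEdges_le _)) h2
      omega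

/-- The vertex sets of the trees of a forest. -/
def treesOf (F : SimpleGraph V) : Set (Set V) :=
  Set.range fun c : F.ConnectedComponent => c.supp

theorem mem_treesOf_iff : T ∈ F.treesOf ↔ ∃ x, T = {y | F.Reachable x y} := by
  have h : ∀ x, (F.connectedComponentMk x).supp = {y | F.Reachable x y} := fun x => by
    ext y
    exact (ConnectedComponent.eq (G := F)).trans reachable_comm
  constructor
  · rintro ⟨c, rfl⟩
    induction c using ConnectedComponent.ind with | _ x => exact ⟨x, h x⟩
  · rintro ⟨x, rfl⟩
    exact ⟨F.connectedComponentMk x, h x⟩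

theorem encard_treesOf [Finite V] : F.treesOf.encard = Nat.card F.ConnectedComponent := by
  rw [treesOf, ← Set.image_univ, ConnectedComponent.supp_injective.encard_image, Set.encard_univ,
    ENat.card_eq_coe_natCard]

theorem isTreeCovering_treesOf (hF : F.IsAcyclic) (hle : F ≤ G)
    (hclosed : ∀ x y, G.Adj x y → F.Reachable x y → F.Adj x y) :
    G.IsTreeCovering F.treesOf := by
  refine ⟨?_, ?_, fun v => ⟨_, mem_treesOf_iff.2 ⟨v, rfl⟩, Reachable.refl v⟩⟩
  · rintro _ ⟨c, rfl⟩
    have : G.induce c.supp = F.induce c.supp := by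
      ext x y
      have hxy : F.Reachable x y := c.reachable_of_mem_supp x.2 y.2
      exact ⟨fun h => hclosed x y h hxy, fun h => hle h⟩
    rw [this]
    exact hF.isTree_connectedComponent c
  · intro S hS T hT hne
    obtain ⟨x, rfl⟩ := mem_treesOf_iff.1 hS
    obtain ⟨y, rfl⟩ := mem_treesOf_iff.1 hT
    refine Set.disjoint_left.2 fun z hz hz' => hne ?_
    have hxy : F.Reachable x y := Reachable.trans hz (Reachable.symm hz')
    ext w
    exact ⟨hxy.symm.trans, hxy.trans⟩

/-- The union of the trees of a tree covering. -/
def forestOf (G : SimpleGraph V) (𝒮 : Set (Set V)) : SimpleGraph V where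
  Adj x y := G.Adj x y ∧ ∃ S ∈ 𝒮, x ∈ S ∧ y ∈ S
  symm := ⟨fun _ _ ⟨h, S, hS, hx, hy⟩ => ⟨h.symm, S, hS, hy, hx⟩⟩
  loopless := ⟨fun _ h => h.1.ne rfl⟩

theorem IsTreeCovering.eq_of_mem (h : G.IsTreeCovering 𝒮) {S T : Set V} (hS : S ∈ 𝒮) (hT : T ∈ 𝒮)
    (hxS : x ∈ S) (hxT : x ∈ T) : S = T := by
  by_contra hne
  exact Set.disjoint_left.1 (h.disjoint S hS T hT hne) hxS hxT

theorem IsTreeCovering.reachable_forestOf_iff (h : G.IsTreeCovering 𝒮) {S : Set V} (hS : S ∈ 𝒮)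
    (hx : x ∈ S) : (G.forestOf 𝒮).Reachable x y ↔ y ∈ S := by
  constructor
  · intro hr
    refine hr.induction_on hx fun p q _ hp hpq => ?_
    obtain ⟨-, T, hT, hpT, hqT⟩ := hpq
    rwa [h.eq_of_mem hS hT hp hpT]
  · intro hy
    let f : G.induce S →g G.forestOf 𝒮 :=
      { toFun := Subtype.val
        map_rel' := fun {p q} hpq => ⟨hpq, S, hS, p.2, q.2⟩ }
    exact ((h.isTree S hS).connected.preconnected ⟨x, hx⟩ ⟨y, hy⟩).map f

theorem IsTreeCovering.treesOf_forestOf (h : G.IsTreeCovering 𝒮) :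
    (G.forestOf 𝒮).treesOf = 𝒮 := by
  ext T
  rw [mem_treesOf_iff]
  constructor
  · rintro ⟨x, rfl⟩
    obtain ⟨S, hS, hx⟩ := h.cover x
    convert! hS using 1
    ext y
    exact h.reachable_forestOf_iff hS hx
  · intro hT
    obtain ⟨⟨x, hx⟩⟩ := (h.isTree T hT).connected.nonempty
    refine ⟨x, ?_⟩
    ext y
    exact (h.reachable_forestOf_iff hT hx).symm

theorem IsTreeCovering.isAcyclic_forestOf (h : G.IsTreeCovering 𝒮) :
    (G.forestOf 𝒮).IsAcyclic := by
  rw [isAcyclic_iff_forall_adj_isBridge]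
  rintro a b ⟨hab, S, hS, ha, hb⟩
  rw [isBridge_iff]
  intro hr
  have hab' : (G.induce S).Adj ⟨a, ha⟩ ⟨b, hb⟩ := hab
  have key := hr.induction_on (P := fun y => ∃ hy : y ∈ S,
    ((G.induce S).deleteEdges {s(⟨a, ha⟩, ⟨b, hb⟩)}).Reachable ⟨a, ha⟩ ⟨y, hy⟩)
    ⟨ha, Reachable.refl _⟩ ?_
  · exact (h.isTree S hS).isAcyclic.not_reachable_deleteEdges hab' key.2
  · rintro p q - ⟨hp, hap⟩ hpq
    rw [deleteEdges_adj] at hpq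
    obtain ⟨⟨hadj, T, hT, hpT, hqT⟩, hne⟩ := hpq
    have hq : q ∈ S := h.eq_of_mem hT hS hpT hp ▸ hqT
    refine ⟨hq, hap.trans (Adj.reachable ?_)⟩
    rw [deleteEdges_adj]
    refine ⟨hadj, fun he => hne ?_⟩
    simpa [Sym2.eq_iff] using he

open Classical in
/-- A simple graph as a weighted graph with weights zero and one. -/
noncomputable def toWGraph (G : SimpleGraph V) : WGraph V where
  w x y := if G.Adj x y then 1 else 0
  symm x y := by simp only [G.adj_comm]
  irrefl x := by simp

theorem toWGraph_w_ne_zero : G.toWGraph.w x y ≠ 0 ↔ G.Adj x y := by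
  simp [toWGraph]

theorem toWGraph_w_le : G.toWGraph.w x y ≤ 1 := by
  simp only [toWGraph]
  split_ifs <;> simp

theorem toWGraph_graph : G.toWGraph.graph = G := by
  ext x y
  exact toWGraph_w_ne_zero

theorem val_toWGraph (hle : F ≤ G) : G.toWGraph.val F = F.edgeSet.ncard := by
  unfold WGraph.val
  rw [Set.inter_eq_left.2]
  intro e he
  induction e with
  | _ x y => exact if_pos (hle he)

theorem IsOuterplanar.not_hasK23 [Finite V] (hG : G.IsOuterplanar) : ¬ G.toWGraph.HasK23 := by
  rintro ⟨A, B, C, s, hmod, hs⟩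
  obtain rfl : s = 0 := by
    rcases hs with hs | ⟨a, -, b, -, hab⟩
    · exact hs
    · have := toWGraph_w_le (G := G) (x := a) (y := b)
      omega
  rw [toWGraph_graph] at hmod
  exact hG.not_K23_model (C := fun i : Fin 3 => C i) hmod.connLeft hmod.connRight
    (fun i => hmod.conn i (Nat.zero_le _) i.2) hmod.disj
    (fun i => hmod.disjLeft i (Nat.zero_le _) i.2) (fun i => hmod.disjRight i (Nat.zero_le _) i.2)
    (fun i j hij => hmod.pairwise i j (Nat.zero_le _) i.2 (Nat.zero_le _) j.2
      fun h => hij (Fin.ext h))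
    (fun i => hmod.touchLeft i (Nat.zero_le _) i.2) (fun i => hmod.touchRight i (Nat.zero_le _) i.2)

/-- With all weights at most 1 the value is the number of edges, and components and edges of a
forest add up to the number of vertices; the most edges means the fewest trees. -/
theorem isMinimumTreeCovering_treesOf [Finite V] (hF : G.toWGraph.Optimal F) :
    G.IsMinimumTreeCovering F.treesOf := by
  have hle : F ≤ G := fun x y h => toWGraph_w_ne_zero.1 (hF.1.ne_zero x y h)
  refine ⟨isTreeCovering_treesOf hF.1.acyclic hle fun x y h =>
    hF.1.closed x y (toWGraph_w_ne_zero.2 h), fun 𝒮 h𝒮 => ?_⟩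
  have hle' : G.forestOf 𝒮 ≤ G := fun x y h => h.1
  have hvalid : G.toWGraph.Valid (G.forestOf 𝒮) :=
    ⟨h𝒮.isAcyclic_forestOf, fun x y h => toWGraph_w_ne_zero.2 h.1,
      fun x y _ => toWGraph_w_le.trans one_le_two, fun x y hxy hr => by
        obtain ⟨S, hS, hx⟩ := h𝒮.cover x
        exact ⟨toWGraph_w_ne_zero.1 hxy, S, hS, hx, (h𝒮.reachable_forestOf_iff hS hx).1 hr⟩⟩
  have hval := hF.2 _ hvalid
  rw [val_toWGraph hle, val_toWGraph hle'] at hval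
  have h1 := hF.1.acyclic.card_connectedComponent_add_ncard_edgeSet
  have h2 := h𝒮.isAcyclic_forestOf.card_connectedComponent_add_ncard_edgeSet
  rw [← h𝒮.treesOf_forestOf, encard_treesOf, encard_treesOf]
  exact_mod_cast (by omega : Nat.card F.ConnectedComponent ≤
    Nat.card (G.forestOf 𝒮).ConnectedComponent)

theorem HasPendant.exists_isPendantTree {r : V} (h : G.HasPendant F r) :
    ∃ T, G.IsPendantTree F.treesOf T := by
  obtain ⟨x, -, ⟨p, q, hxp, hpq, hxq⟩, huniq⟩ := h
  refine ⟨{y | F.Reachable x y}, mem_treesOf_iff.2 ⟨x, rfl⟩, {y | F.Reachable q y},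
    ⟨mem_treesOf_iff.2 ⟨q, rfl⟩, fun h => hxq ?_, p, hxp, q, Reachable.refl q, hpq⟩, ?_⟩
  · have hq : q ∈ {y | F.Reachable q y} := Reachable.refl q
    rwa [h] at hq
  · rintro S ⟨hS, hne, p', hp', q', hq', hpq'⟩
    obtain ⟨z, rfl⟩ := mem_treesOf_iff.1 hS
    have hzq : F.Reachable z q' := hq'
    have hxq' : ¬ F.Reachable x q' := by
      intro h
      refine hne ?_
      have hzx : F.Reachable z x := hzq.trans h.symm
      ext w
      exact ⟨hzx.symm.trans, hzx.trans⟩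
    have hqz : F.Reachable q z :=
      (huniq p q p' q' hxp hpq hxq hp' hpq' hxq').trans hzq.symm
    ext w
    exact ⟨hqz.trans, hqz.symm.trans⟩

end SimpleGraph

theorem theorem8p2 {V : Type*} [Finite V] (G : SimpleGraph V) (hG : G.IsOuterplanar)
    (hcyc : ¬ G.IsAcyclic) :
    ∃ 𝒯 : Set (Set V), G.IsMinimumTreeCovering 𝒯 ∧ ∃ T : Set V, G.IsPendantTree 𝒯 T := by
  obtain ⟨r⟩ : Nonempty V := by
    by_contra h
    rw [not_nonempty_iff] at h
    exact hcyc SimpleGraph.IsAcyclic.of_subsingleton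
  obtain ⟨F, hF, ⟨x, y, -, h2⟩ | hp⟩ := WGraph.good_of_cyclic G.toWGraph
    (by rw [SimpleGraph.toWGraph_graph]; exact hG.not_hasK4Minor) hG.not_hasK23
    (Or.inl (by rwa [SimpleGraph.toWGraph_graph])) r
  -- The original graph has no edge of weight 2, so only the pendant alternative of `WGraph.Good`
  -- remains.
  · have := SimpleGraph.toWGraph_w_le (G := G) (x := x) (y := y)
    omega
  · rw [SimpleGraph.toWGraph_graph] at hp
    exact ⟨F.treesOf, SimpleGraph.isMinimumTreeCovering_treesOf hF, hp.exists_isPendantTree⟩
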